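/- Let $d\ge 1$, let $E$ be the set of edges $\{u,v\}$, $\|u-v\|_1=1$, of the lattice $\mathbb{Z}^d$, and let $N(u)$ be the set of neighbours of $u$. Write $e\sim e'$ if the edges $e\ne e'$ share an end point. Let $\chi$ be a finite set of spin values, $H:\chi^2\to\mathbb{R}\cup\{\infty\}$ symmetric and $h:\chi\to\mathbb{R}$. In the edge model, a configuration $(s_e)\in\chi^{F}$ on a finite set $F\subset E$ has the weight $$w_F(s)=\exp\Big(-\sum_{\{e,e'\}\subset F,\ e\sim e'}H(s_e,s_{e'})-\sum_{e\in F}h(s_e)\Big),$$ with $\exp(-\infty)=0$; $\mathbb{P}_F$ is the probability measure on $\chi^F$ proportional to $w_F$. For a finite $\Lambda\subset\mathbb{Z}^d$ let $E(\Lambda)$ be the set of edges with both end points in $\Lambda$, and $Z_\Lambda=\sum_{s\in\chi^{E(\Lambda)}}w_{E(\Lambda)}(s)$. A Gibbs measure is a probability measure on $\chi^E$ whose conditional law in each finite set of edges, given the spins outside of it, is the one determined by these weights. For $X\subset E$ let $B_r(X)$ be the set of edges at distance at most $r$ from $X$ with respect to the relation $\sim$, and let $\partial_rX$ be the set of edges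 in $B_r(X)$ that are $\sim$-related to an edge outside of $B_r(X)$. Assume * (spin $s^*$) $s^*\in\chi$ satisfies $H(s,s^*)<\infty$ for all $s\in\chi$; * (strong spatial mixing) for every finite $X\subset E$ and every (possibly infinite) $Y\subset E$ there is a function $R$ with $R(r)\to0$ as $r\to\infty$, such that for all integers $r\ge1$ and all spin assignments $s^1$ on $X$, $s^2$ on $Y$, and $s^3,s^4$ on $\partial_rX$, $$\big|\mathbb{P}(\sigma_X=s^1\mid\sigma_Y=s^2,\sigma_{\partial_rX}=s^3)-\mathbb{P}(\sigma_X=s^1\mid\sigma_Y=s^2,\sigma_{\partial_rX}=s^4)\big|\le R(r),$$ whenever both conditions are feasible. Here the conditional probabilities are those of $\mathbb{P}_{B_r(X)}$, given the spins in $(Y\cap B_r(X))\cup\partial_rX$. Then there is exactly one Gibbs measure $\mathbb{P}$. Let $\prec$ be the lexicographic order on $\mathbb{Z}^d$ (last coordinate most significant), let $\mathcal{E}$ be the event that $\sigma_{(u,w)}=s^*$ for all $u\succ0$ and $w\in N(u)$, and let $\mathcal{E}_{\mathrm{even}}$ be the event that $\sigma_{(u,w)}=s^*$ for all $u\succ 0$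 with $\sum_iu_i$ even and $w\in N(u)$. The conditional probabilities of the event $\{\sigma_{(0,v)}=s^*\ \forall v\in N(0)\}$ given $\mathcal{E}$ and given $\mathcal{E}_{\mathrm{even}}$, defined as the limits of the conditional probabilities given that the spins in $F$ equal $s^*$ along the finite sets $F$ of the edges concerned, directed by inclusion, exist and are positive. The free energy $\mathcal{P}(d,H,h)=\lim_n \log Z_{\Lambda_n}/|\Lambda_n|$ exists and is the same for all sequences of finite non-empty sets $\Lambda_n\subset\mathbb{Z}^d$ such that $|\partial\Lambda_n|/|\Lambda_n|\to0$, where $\partial\Lambda=\{v\in\Lambda: N(v)\not\subset\Lambda\}$. Moreover, $$\mathcal{P}(d,H,h)=-\log\mathbb{P}\big(\sigma_{(0,v)}=s^*\ \forall v\in N(0)\mid\mathcal{E}\big)-d(2d-1)H(s^*,s^*)-d\,h(s^*)$$ $$\phantom{\mathcal{P}(d,H,h)}=-\tfrac12\log\mathbb{P}\big(\sigma_{(0,v)}=s^*\ \forall v\in N(0)\mid\mathcal{E}_{\mathrm{even}}\big)-d(2d-1)H(s^*,s^*)-d\,h(s^*).$$ -/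

import Mathlib

open Filter Topology MeasureTheory

namespace SpinSystem

/-! ### Pair interactions and Gibbs weights on finite induced subsystems -/

/-- A nearest neighbour spin model with spin values `χ`: a Hamiltonian `H` with values in
`ℝ ∪ {∞}` (symmetric, because it is evaluated on undirected pairs) and an external field `h`. -/
structure Model (χ : Type*) where
  H : χ → χ → WithTop ℝ
  symm : ∀ a b, H a b = H b a
  h : χ → ℝ

/-- `H` as a function of an unordered pair of spin values. -/
def Model.pair {χ : Type*} (M : Model χ) : Sym2 χ → WithTop ℝ :=
  Sym2.lift ⟨M.H, M.symm⟩

open Classical in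
/-- `exp (-x)` for `x ∈ ℝ ∪ {∞}`, with `exp (-∞) = 0`. -/
noncomputable def expNeg (x : WithTop ℝ) : ℝ :=
  if x = ⊤ then 0 else Real.exp (-(x.untopD 0))

section Finite

variable {V χ : Type*}

open Classical in
/-- The energy of the configuration `τ ∈ χ ^ A` in the subsystem induced by the finite set `A`:
the sum of `H` over the undirected edges of the induced subgraph, plus the sum of `h` over `A`. -/
noncomputable def energy (G : SimpleGraph V) (M : Model χ) (A : Finset V) (τ : A → χ) :
    WithTop ℝ :=
  (∑ e ∈ (G.comap (fun v : A => (v : V))).edgeFinset, M.pair (e.map τ))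
    + ∑ v : A, ((M.h (τ v) : ℝ) : WithTop ℝ)

/-- The Gibbs weight of a configuration on the finite set `A`. -/
noncomputable def weight (G : SimpleGraph V) (M : Model χ) (A : Finset V) (τ : A → χ) : ℝ :=
  expNeg (energy G M A τ)

open Classical in
/-- The total Gibbs weight of a set `S` of configurations on the finite set `A`. -/
noncomputable def weightOf [Fintype χ] (G : SimpleGraph V) (M : Model χ) (A : Finset V)
    (S : Set (A → χ)) : ℝ :=
  ∑ τ : A → χ with τ ∈ S, weight G M A τ

/-- The partition function `Z_A` of the subsystem induced by the finite set `A`. -/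
noncomputable def partitionFunction [Fintype χ] (G : SimpleGraph V) (M : Model χ)
    (A : Finset V) : ℝ :=
  weightOf G M A Set.univ

/-- The conditional probability `ℙ_A(S | T)` for the Gibbs measure `ℙ_A` of the finite subsystem
induced by `A` (the normalization by `Z_A` cancels).  It is meaningful if `weightOf G M A T ≠ 0`. -/
noncomputable def finCondProb [Fintype χ] (G : SimpleGraph V) (M : Model χ) (A : Finset V)
    (S T : Set (A → χ)) : ℝ :=
  weightOf G M A (S ∩ T) / weightOf G M A T

end Finite

/-! ### Gibbs measures on infinite graphs -/

section Infinite

variable {V χ : Type*}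

/-- `μ` is a Gibbs measure: whenever `Λ ⊆ Δ` are finite sets of sites and `Δ` contains all the
neighbours of `Λ`, the conditional law under `μ` of the spins in `Λ`, given the spins in `Δ \ Λ`,
is the one of the finite Gibbs measure on `Δ`.  (Given the spins in `Δ \ Λ`, that law only involves
the interactions inside `Λ` and those between `Λ` and its neighbours, so this is the usual
DLR condition.) -/
structure IsGibbsMeasure [Fintype χ] [MeasurableSpace χ] (G : SimpleGraph V) (M : Model χ)
    (μ : Measure (V → χ)) : Prop where
  isProbabilityMeasure : IsProbabilityMeasure μ
  dlr : ∀ Λ Δ : Finset V, Λ ⊆ Δ → (∀ v ∈ Λ, ∀ u, G.Adj v u → u ∈ Δ) → ∀ σ : V → χ,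
    μ.real {ω | ∀ v ∈ Δ, ω v = σ v} =
      finCondProb G M Δ {τ | ∀ v : Δ, (v : V) ∈ Λ → τ v = σ v}
          {τ | ∀ v : Δ, (v : V) ∉ Λ → τ v = σ v}
        * μ.real {ω | ∀ v ∈ Δ, v ∉ Λ → ω v = σ v}

/-- The conditional probability of the event `S` given that all the spins in the (possibly
infinite) set `Y` are equal to `s` exists and is equal to `p`.  As this event may have measure
zero, the conditional probability is the limit of the conditional probabilities given
that the spins in `F` are equal to `s`, along the finite subsets `F` of `Y` directed by
inclusion. -/
def HasCondProb [MeasurableSpace χ] (μ : Measure (V → χ)) (S : Set (V → χ)) (Y : Set V) (s : χ)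
    (p : ℝ) : Prop :=
  Tendsto (fun F : Finset Y =>
    (ProbabilityTheory.cond μ {ω | ∀ v ∈ F, ω (v : V) = s}).real S) atTop (𝓝 p)

/-! ### Strong spatial mixing -/

/-- `B_r(X)`: the set of nodes at graph distance at most `r` from `X`. -/
def ball (G : SimpleGraph V) (X : Set V) (r : ℕ) : Set V :=
  {u | ∃ v ∈ X, G.edist v u ≤ (r : ℕ∞)}

/-- `∂A`: the nodes in `A` which have a neighbour outside of `A`. -/
def boundary (G : SimpleGraph V) (A : Set V) : Set V :=
  {v | v ∈ A ∧ ∃ u, G.Adj v u ∧ u ∉ A}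

/-- The event "`τ` agrees with `s²` on `Y` and with `s³` on the boundary of `B`", for
configurations on a finite set `B`. -/
def boundaryEvent (G : SimpleGraph V) (B : Finset V) (Y : Set V) (s2 s3 : V → χ) :
    Set (B → χ) :=
  {τ | (∀ v : B, (v : V) ∈ Y → τ v = s2 v) ∧
    ∀ v : B, (v : V) ∈ boundary G (B : Set V) → τ v = s3 v}

/-- Strong spatial mixing (for a locally finite graph).  With the spins on the boundary of
`B = B_r(X)` fixed, the conditional law of the spins in `B` is the one of the finite
Gibbs measure on `B`, and only the part of `Y` inside `B` matters.  Only assignments for which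
the conditioning event has positive weight are compared. -/
def StrongSpatialMixing [Fintype χ] (G : SimpleGraph V) (M : Model χ) : Prop :=
  ∀ (X : Finset V) (Y : Set V), ∃ R : ℕ → ℝ, Tendsto R atTop (𝓝 0) ∧
    ∀ r : ℕ, 1 ≤ r → ∀ B : Finset V, (B : Set V) = ball G (X : Set V) r →
      ∀ s1 s2 s3 s4 : V → χ,
        weightOf G M B (boundaryEvent G B Y s2 s3) ≠ 0 →
        weightOf G M B (boundaryEvent G B Y s2 s4) ≠ 0 →
        |finCondProb G M B {τ | ∀ v : B, (v : V) ∈ X → τ v = s1 v} (boundaryEvent G B Y s2 s3)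
          - finCondProb G M B {τ | ∀ v : B, (v : V) ∈ X → τ v = s1 v}
              (boundaryEvent G B Y s2 s4)| ≤ R r

/-- In a graph with finite neighbourhoods all the balls `B_r(X)` around finite sets are finite. -/
theorem ball_finite (G : SimpleGraph V) (hG : ∀ v, (G.neighborSet v).Finite) {X : Set V}
    (hX : X.Finite) (r : ℕ) : (ball G X r).Finite := by
  induction r with
  | zero =>
    refine hX.subset ?_
    rintro u ⟨v, hv, h⟩
    have : v = u := by simpa using h
    exact this ▸ hv
  | succ r ih =>
    refine (ih.union (ih.biUnion fun v _ => hG v)).subset ?_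
    rintro u ⟨v, hv, h⟩
    have hne : G.edist v u ≠ ⊤ := fun h' => by
      rw [h'] at h
      exact absurd h (by simp)
    obtain ⟨p, hp⟩ := (SimpleGraph.edist_ne_top_iff_reachable.1 hne).exists_walk_length_eq_edist
    rw [← hp] at h
    have hl : p.length ≤ r + 1 := by exact_mod_cast h
    clear hp hne h
    rcases Nat.lt_or_ge r p.length with hlt | hle
    · right
      have hnn : ¬ p.reverse.Nil := by
        intro hn
        have := SimpleGraph.Walk.length_eq_zero_iff.2 hn
        rw [SimpleGraph.Walk.length_reverse] at this
        omega
      obtain ⟨w, hw, q, hq⟩ := SimpleGraph.Walk.not_nil_iff.1 hnn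
      have hql : q.length = r := by
        have := congrArg SimpleGraph.Walk.length hq
        rw [SimpleGraph.Walk.length_reverse, SimpleGraph.Walk.length_cons] at this
        omega
      refine Set.mem_biUnion (x := w) ⟨v, hv, ?_⟩ hw.symm
      rw [SimpleGraph.edist_comm, ← hql]
      exact q.edist_le
    · exact Or.inl ⟨v, hv, p.edist_le.trans (by exact_mod_cast hle)⟩

end Infinite

/-! ### The lattice and the edge model on it -/

/-- The `d`-dimensional lattice `ℤ ^ d`: `v` and `u` are adjacent iff `∑ |v_i - u_i| = 1`. -/
def lattice (d : ℕ) : SimpleGraph (Fin d → ℤ) where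
  Adj v u := ∑ i, |v i - u i| = 1
  symm := ⟨fun v u h => by simpa only [abs_sub_comm] using h⟩
  loopless := ⟨fun v h => by simp at h⟩

/-- The edges of `ℤ ^ d`: the sites of the edge model. -/
abbrev LatticeEdge (d : ℕ) : Type := (lattice d).edgeSet

/-- The graph of interactions of the edge model: two edges of `ℤ ^ d` interact iff they are
distinct and share a node. -/
abbrev edgeGraph (d : ℕ) : SimpleGraph (LatticeEdge d) := (lattice d).lineGraph

open Classical in
/-- `E(Λ)`: the edges of `ℤ ^ d` with both end points in the finite set `Λ` of nodes. -/
noncomputable def edgesIn (d : ℕ) (Λ : Finset (Fin d → ℤ)) : Finset (LatticeEdge d) :=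
  Λ.sym2.subtype (fun e => e ∈ (lattice d).edgeSet)

/-- `P` is the pressure (free energy per node) of the edge model: `log Z_Λ / |Λ|` tends to `P`,
where `Z_Λ` is the partition function of the edge model on the subgraph induced by `Λ`, along
every sequence of finite non-empty sets of nodes for which the proportion of boundary nodes tends
to zero. -/
def IsPressure {χ : Type*} [Fintype χ] (d : ℕ) (M : Model χ) (P : ℝ) : Prop :=
  ∀ Λ : ℕ → Finset (Fin d → ℤ), (∀ n, (Λ n).Nonempty) →
    Tendsto (fun n => ((boundary (lattice d) (Λ n : Set (Fin d → ℤ))).ncard : ℝ) / (Λ n).card)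
      atTop (𝓝 0) →
    Tendsto (fun n => Real.log (partitionFunction (edgeGraph d) M (edgesIn d (Λ n))) / (Λ n).card)
      atTop (𝓝 P)

/-- The lexicographic order `v ≺ u` on `ℤ ^ d`, the last coordinate being the most significant. -/
def LexLT {d : ℕ} (v u : Fin d → ℤ) : Prop :=
  ∃ k, v k < u k ∧ ∀ j, k < j → v j = u j

/-- The edges `(u, w)`, `w ∈ N(u)`, with `u ≻ 0`. -/
def laterEdges (d : ℕ) : Set (LatticeEdge d) :=
  {e | ∃ u ∈ (e : Sym2 (Fin d → ℤ)), LexLT 0 u}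

/-- The edges `(u, w)`, `w ∈ N(u)`, with `u ≻ 0` and `∑ u_i` even. -/
def laterEvenEdges (d : ℕ) : Set (LatticeEdge d) :=
  {e | ∃ u ∈ (e : Sym2 (Fin d → ℤ)), LexLT 0 u ∧ Even (∑ i, u i)}

/-- The event that all the edges at the origin have spin `s`. -/
def originEvent {χ : Type*} (d : ℕ) (s : χ) : Set (LatticeEdge d → χ) :=
  {ω | ∀ e : LatticeEdge d, (0 : Fin d → ℤ) ∈ (e : Sym2 (Fin d → ℤ)) → ω e = s}

end SpinSystem

/-! Strong spatial mixing makes the conditional probability of the spins on a finite set, given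
`s*` on a possibly infinite set, a bulk quantity: it has almost the same value in every system
that is Gibbsian inside a large ball, whether that system is a finite Gibbs measure with some
boundary condition or the marginal of an infinite one. This yields the uniqueness of the Gibbs
measure and the existence of the conditional probabilities given `ℰ` and `ℰ_even`. They are
positive because changing finitely many spins to `s*` is always feasible and costs a bounded
factor; existence of the Gibbs measure is compactness.

For the free energy, let `U` be a sublattice that contains an end point of every edge, and
reveal the spins at the nodes of `Λ ∩ U` in decreasing lexicographic order. By the chain rule
the probability `w(s*) / Z_Λ` of the constant configuration is the product over `v ∈ Λ ∩ U` of
the conditional probabilities that the edges at `v` have spin `s*`, given that those at the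
later nodes of `U` do. By translation invariance under `U` and mixing, all but a vanishing
proportion of the factors are close to the one at the origin of the infinite lattice, and all of
them are bounded away from zero. Hence `log Z_Λ / |Λ|` is asymptotically
`log w(s*) / |Λ| - κ log p`, where `κ` is the density of `U`; the two formulas are the cases of
all nodes, `κ = 1`, and of the even ones, `κ = 1 / 2`. -/

namespace SpinSystem

section Weights

variable {V χ : Type*}

theorem expNeg_coe (x : ℝ) : expNeg x = Real.exp (-x) := by simp [expNeg]

theorem expNeg_add (x y : WithTop ℝ) : expNeg (x + y) = expNeg x * expNeg y := by
  induction x with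
  | top => simp [expNeg]
  | coe x =>
    induction y with
    | top => simp [expNeg]
    | coe y =>
      rw [← WithTop.coe_add, expNeg_coe, expNeg_coe, expNeg_coe, neg_add, Real.exp_add]

theorem expNeg_nonneg (x : WithTop ℝ) : 0 ≤ expNeg x := by
  unfold expNeg
  split_ifs
  · exact le_rfl
  · exact (Real.exp_pos _).le

theorem expNeg_ne_zero {x : WithTop ℝ} : expNeg x ≠ 0 ↔ x ≠ ⊤ := by
  unfold expNeg
  split_ifs with h <;> simp [h, Real.exp_ne_zero]

theorem restrict_extend (A : Finset V) (τ : A → χ) (η : V → χ) :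
    A.restrict (Function.extend Subtype.val τ η) = τ :=
  funext fun v => Subtype.val_injective.extend_apply τ η v

open Classical in
/-- The interacting pairs of sites in `A`. -/
noncomputable def bonds (G : SimpleGraph V) (A : Finset V) : Finset (Sym2 V) :=
  A.sym2.filter (· ∈ G.edgeSet)

theorem mk_mem_bonds {G : SimpleGraph V} {A : Finset V} {u v : V} :
    s(u, v) ∈ bonds G A ↔ (u ∈ A ∧ v ∈ A) ∧ G.Adj u v := by
  simp [bonds]

theorem bonds_mono (G : SimpleGraph V) {A B : Finset V} (h : B ⊆ A) : bonds G B ⊆ bonds G A := by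
  classical
  exact Finset.filter_subset_filter _ (Finset.sym2_mono h)

theorem energy_restrict (G : SimpleGraph V) (M : Model χ) (A : Finset V) (σ : V → χ) :
    energy G M A (A.restrict σ) =
      (∑ e ∈ bonds G A, M.pair (e.map σ)) + ∑ v ∈ A, ((M.h (σ v) : ℝ) : WithTop ℝ) := by
  unfold energy
  congr 1
  · refine Finset.sum_bij (fun e _ => e.map Subtype.val) ?_ ?_ ?_ ?_
    · rintro ⟨u, v⟩ he
      simpa [mk_mem_bonds] using he
    · exact fun e _ f _ h => Sym2.map.injective Subtype.val_injective h
    · rintro ⟨u, v⟩ he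
      obtain ⟨⟨hu, hv⟩, huv⟩ := mk_mem_bonds.1 he
      exact ⟨s(⟨u, hu⟩, ⟨v, hv⟩), by simpa using huv, by simp⟩
    · intro e _
      rw [Sym2.map_map]
      rfl
  · exact Finset.sum_coe_sort A fun v => ((M.h (σ v) : ℝ) : WithTop ℝ)

theorem weight_nonneg (G : SimpleGraph V) (M : Model χ) (A : Finset V) (τ : A → χ) :
    0 ≤ weight G M A τ := expNeg_nonneg _

theorem weight_restrict_ne_zero_iff (G : SimpleGraph V) (M : Model χ) (A : Finset V)
    (σ : V → χ) :
    weight G M A (A.restrict σ) ≠ 0 ↔ ∀ u ∈ A, ∀ v ∈ A, G.Adj u v → M.H (σ u) (σ v) ≠ ⊤ := by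
  rw [weight, expNeg_ne_zero, energy_restrict, WithTop.add_ne_top, WithTop.sum_ne_top,
    WithTop.sum_ne_top]
  constructor
  · exact fun h u hu v hv huv => h.1 s(u, v) (mk_mem_bonds.2 ⟨⟨hu, hv⟩, huv⟩)
  · refine fun h => ⟨?_, fun v _ => WithTop.coe_ne_top⟩
    rintro ⟨u, v⟩ he
    obtain ⟨⟨hu, hv⟩, huv⟩ := mk_mem_bonds.1 he
    exact h u hu v hv huv

/-- The configurations on `A` which agree with `σ` on `F`. -/
def cyl (A : Finset V) (F : Set V) (σ : V → χ) : Set (A → χ) :=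
  {τ | ∀ v : A, (v : V) ∈ F → τ v = σ v}

theorem restrict_mem_cyl_iff {A : Finset V} {F : Set V} {ω σ : V → χ} :
    A.restrict ω ∈ cyl A F σ ↔ ∀ v ∈ A, v ∈ F → ω v = σ v :=
  ⟨fun h v hv => h ⟨v, hv⟩, fun h v => h v v.2⟩

theorem cyl_inter_cyl (A : Finset V) (F F' : Set V) (σ : V → χ) :
    cyl A F σ ∩ cyl A F' σ = cyl A (F ∪ F') σ := by
  ext τ
  exact ⟨fun h v hv => hv.elim (h.1 v) (h.2 v),
    fun h => ⟨fun v hv => h v (.inl hv), fun v hv => h v (.inr hv)⟩⟩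

theorem cyl_congr {A : Finset V} {F F' : Set V} (h : ∀ v ∈ A, v ∈ F ↔ v ∈ F') (σ : V → χ) :
    cyl A F σ = cyl A F' σ :=
  Set.ext fun _ => forall_congr' fun v => by rw [h v v.2]

theorem cyl_anti {A : Finset V} {F F' : Set V} (h : F ⊆ F') (σ : V → χ) :
    cyl A F' σ ⊆ cyl A F σ := fun _ hτ v hv => hτ v (h hv)

theorem cyl_inter_cyl_eq_or_eq_empty (A : Finset V) {E F : Set V} (h : E ⊆ F) (σ η : V → χ) :
    cyl A E σ ∩ cyl A F η = cyl A F η ∨ cyl A E σ ∩ cyl A F η = ∅ := by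
  by_cases hσ : ∀ v ∈ A, v ∈ E → η v = σ v
  · exact .inl (Set.inter_eq_right.2 fun τ hτ v hv => (hτ v (h hv)).trans (hσ v v.2 hv))
  · push Not at hσ
    obtain ⟨v, hvA, hvE, hne⟩ := hσ
    refine .inr (Set.eq_empty_of_forall_notMem fun τ hτ => hne ?_)
    exact (hτ.2 ⟨v, hvA⟩ (h hvE)).symm.trans (hτ.1 ⟨v, hvA⟩ hvE)

theorem preimage_restrict₂_cyl {A B : Finset V} (hBA : B ⊆ A) {F : Set V}
    (hF : ∀ v ∈ A, v ∈ F → v ∈ B) (σ : V → χ) :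
    Finset.restrict₂ (π := fun _ => χ) hBA ⁻¹' cyl B F σ = cyl A F σ :=
  Set.ext fun _ => ⟨fun h v hv => h ⟨v, hF v v.2 hv⟩ hv, fun h v hv => h ⟨v, hBA v.2⟩ hv⟩

theorem cyl_eq_preimage_restrict₂_inter {A B : Finset V} (hBA : B ⊆ A) (F : Set V) (σ : V → χ) :
    cyl A F σ =
      Finset.restrict₂ (π := fun _ => χ) hBA ⁻¹' cyl B F σ ∩ cyl A (F \ B) σ := by
  rw [cyl_congr (F := F) (F' := F ∩ B ∪ F \ B) (by simp), ← cyl_inter_cyl,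
    cyl_congr (A := B) (F := F) (F' := F ∩ B) (by simp +contextual), preimage_restrict₂_cyl]
  exact fun v _ hv => hv.2

end Weights

section LocalGibbs

variable {V χ : Type*} {G : SimpleGraph V} {M : Model χ} {A B : Finset V} {C : Set V}

/-- The subset `B` of `A` contains `C` and all the sites of `A` which interact with `C`, so that
the spins in `A \ B` do not influence those in `C`. -/
structure Shields (G : SimpleGraph V) (A B : Finset V) (C : Set V) : Prop where
  subset : B ⊆ A
  inner_subset : C ⊆ B
  mem_of_adj : ∀ v ∈ C, ∀ u ∈ A, G.Adj v u → u ∈ B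

/-- The sites of `B` without neighbours outside of `B`. -/
def innerSites (G : SimpleGraph V) (B : Finset V) : Set V :=
  (B : Set V) \ boundary G B

theorem shields_innerSites (G : SimpleGraph V) (h : B ⊆ A) : Shields G A B (innerSites G B) where
  subset := h
  inner_subset := Set.sdiff_subset
  mem_of_adj v hv u _ hvu := by
    by_contra hu
    exact hv.2 ⟨hv.1, u, hvu, hu⟩

theorem Shields.exists_weight_eq_mul (hS : Shields G A B C) (M : Model χ) (η : V → χ) :
    ∃ ρ : ℝ, 0 ≤ ρ ∧ ∀ τ ∈ cyl A Cᶜ η,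
      weight G M A τ = ρ * weight G M B (Finset.restrict₂ (π := fun _ => χ) hS.subset τ) := by
  classical
  refine ⟨expNeg ((∑ e ∈ bonds G A \ bonds G B, M.pair (e.map η))
    + ∑ v ∈ A \ B, ((M.h (η v) : ℝ) : WithTop ℝ)), expNeg_nonneg _, fun τ hτ => ?_⟩
  obtain ⟨σ, rfl⟩ : ∃ σ : V → χ, A.restrict σ = τ := ⟨_, restrict_extend A τ η⟩
  have hση : ∀ v ∈ A, v ∉ C → σ v = η v := restrict_mem_cyl_iff.1 hτ
  have hpair : ∑ e ∈ bonds G A \ bonds G B, M.pair (e.map σ)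
      = ∑ e ∈ bonds G A \ bonds G B, M.pair (e.map η) := by
    refine Finset.sum_congr rfl ?_
    rintro ⟨u, v⟩ he
    obtain ⟨huv, hB⟩ := Finset.mem_sdiff.1 he
    obtain ⟨⟨hu, hv⟩, hadj⟩ := mk_mem_bonds.1 huv
    have hu' : u ∉ C := fun h =>
      hB (mk_mem_bonds.2 ⟨⟨hS.inner_subset h, hS.mem_of_adj u h v hv hadj⟩, hadj⟩)
    have hv' : v ∉ C := fun h =>
      hB (mk_mem_bonds.2 ⟨⟨hS.mem_of_adj v h u hu hadj.symm, hS.inner_subset h⟩, hadj⟩)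
    simp [hση u hu hu', hση v hv hv']
  have hfield : ∑ v ∈ A \ B, ((M.h (σ v) : ℝ) : WithTop ℝ)
      = ∑ v ∈ A \ B, ((M.h (η v) : ℝ) : WithTop ℝ) := by
    refine Finset.sum_congr rfl fun v hv => ?_
    obtain ⟨hvA, hvB⟩ := Finset.mem_sdiff.1 hv
    rw [hση v hvA fun h => hvB (hS.inner_subset h)]
  change weight G M A (A.restrict σ) = _ * weight G M B (B.restrict σ)
  rw [weight, weight, ← expNeg_add, energy_restrict, energy_restrict, ← hpair, ← hfield,
    ← Finset.sum_sdiff (bonds_mono G hS.subset), ← Finset.sum_sdiff hS.subset]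
  congr 1
  abel

/-- The nonnegative function `m` on `χ ^ A`, not necessarily normalized, assigns to the spins
in `C`, given those in `A \ C`, the law determined by the Gibbs weights. -/
def IsLocallyGibbs (G : SimpleGraph V) (M : Model χ) (A : Finset V) (C : Set V)
    (m : (A → χ) → ℝ) : Prop :=
  ∀ η : V → χ, ∃ k : ℝ, 0 ≤ k ∧ ∀ τ ∈ cyl A Cᶜ η, m τ = k * weight G M A τ

theorem isLocallyGibbs_weight (G : SimpleGraph V) (M : Model χ) (A : Finset V) (C : Set V) :
    IsLocallyGibbs G M A C (weight G M A) :=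
  fun _ => ⟨1, zero_le_one, fun _ _ => (one_mul _).symm⟩

theorem IsLocallyGibbs.mono {C' : Set V} {m : (A → χ) → ℝ} (hm : IsLocallyGibbs G M A C m)
    (h : C' ⊆ C) : IsLocallyGibbs G M A C' m := fun η =>
  (hm η).imp fun _ hk => ⟨hk.1, fun τ hτ => hk.2 τ (cyl_anti (Set.compl_subset_compl.2 h) η hτ)⟩

theorem bijOn_restrict₂_cyl (hBA : B ⊆ A) (hCB : C ⊆ B) (η : V → χ) :
    Set.BijOn (Finset.restrict₂ (π := fun _ => χ) hBA) (cyl A Cᶜ η) (cyl B Cᶜ η) := by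
  classical
  refine ⟨fun τ hτ v => hτ ⟨v, hBA v.2⟩, fun τ hτ τ' hτ' h => funext fun v => ?_,
    fun τ hτ => ⟨fun v => if h : (v : V) ∈ B then τ ⟨v, h⟩ else η v, fun v hv => ?_, ?_⟩⟩
  · by_cases hv : (v : V) ∈ C
    · exact congrFun h ⟨v, hCB hv⟩
    · rw [hτ v hv, hτ' v hv]
  · by_cases h : (v : V) ∈ B
    · simpa [h] using hτ ⟨v, h⟩ hv
    · simp [h]
  · ext v
    simp

variable [Fintype χ]

open Classical in
/-- The total mass under `m` of a set of configurations. -/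
noncomputable def mass (m : (A → χ) → ℝ) (S : Set (A → χ)) : ℝ :=
  ∑ τ : A → χ with τ ∈ S, m τ

theorem mass_nonneg {m : (A → χ) → ℝ} (hm : ∀ τ, 0 ≤ m τ) (S : Set (A → χ)) : 0 ≤ mass m S :=
  Finset.sum_nonneg fun τ _ => hm τ

theorem mass_mono {m : (A → χ) → ℝ} (hm : ∀ τ, 0 ≤ m τ) {S T : Set (A → χ)} (h : S ⊆ T) :
    mass m S ≤ mass m T := by
  classical
  exact Finset.sum_le_sum_of_subset_of_nonneg (Finset.monotone_filter_right _ fun τ _ hτ => h hτ)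
    fun τ _ _ => hm τ

theorem mass_pos {m : (A → χ) → ℝ} (hm : ∀ τ, 0 ≤ m τ) {S : Set (A → χ)} {τ : A → χ}
    (hτ : τ ∈ S) (h : m τ ≠ 0) : 0 < mass m S :=
  Finset.sum_pos' (fun τ _ => hm τ) ⟨τ, by simpa using hτ, (hm τ).lt_of_ne' h⟩

@[simp]
theorem mass_empty (m : (A → χ) → ℝ) : mass m ∅ = 0 := by simp [mass]

@[simp]
theorem mass_singleton (m : (A → χ) → ℝ) (τ : A → χ) : mass m {τ} = m τ :=
  (Finset.sum_eq_single_of_mem τ (by simp) fun τ' hτ' hne =>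
    absurd (by simpa using hτ') hne)

theorem exists_of_mass_ne_zero {m : (A → χ) → ℝ} {S : Set (A → χ)} (h : mass m S ≠ 0) :
    ∃ τ ∈ S, m τ ≠ 0 := by
  obtain ⟨τ, hτ, h'⟩ := Finset.exists_ne_zero_of_sum_ne_zero h
  exact ⟨τ, by simpa using hτ, h'⟩

open Classical in
theorem mass_eq_sum_mass_inter_cyl (m : (A → χ) → ℝ) (S : Set (A → χ)) (C : Set V) (η : V → χ) :
    mass m S = ∑ ζ : (A.filter (· ∉ C)) → χ,
      mass m (S ∩ cyl A Cᶜ (Function.extend Subtype.val ζ η)) := by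
  have hfib : ∀ (τ : A → χ) (ζ : (A.filter (· ∉ C)) → χ),
      Finset.restrict₂ (π := fun _ => χ) (A.filter_subset (· ∉ C)) τ = ζ ↔
        τ ∈ cyl A Cᶜ (Function.extend Subtype.val ζ η) := by
    refine fun τ ζ => ⟨?_, fun h => funext fun v => ?_⟩
    · rintro rfl v hv
      exact (Subtype.val_injective.extend_apply (Finset.restrict₂ (π := fun _ => χ) _ τ) η
        (⟨v, Finset.mem_filter.2 ⟨v.2, hv⟩⟩ : A.filter (· ∉ C))).symm
    · exact (h ⟨v, (Finset.mem_filter.1 v.2).1⟩ (Finset.mem_filter.1 v.2).2).trans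
        (Subtype.val_injective.extend_apply ζ η v)
  unfold mass
  rw [← Finset.sum_fiberwise _ (Finset.restrict₂ (π := fun _ => χ) (A.filter_subset (· ∉ C)))]
  refine Finset.sum_congr rfl fun ζ _ => ?_
  rw [Finset.filter_filter]
  exact Finset.sum_congr (by ext τ; simp [hfib τ ζ]) fun _ _ => rfl

theorem mass_eq_mul_mass_of_bijOn {W : Type*} {B : Finset W} {m : (A → χ) → ℝ}
    {m' : (B → χ) → ℝ} {S : Set (A → χ)} {T : Set (B → χ)} {f : (A → χ) → (B → χ)}
    (hf : Set.BijOn f S T) {k : ℝ}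
    (h : ∀ τ ∈ S, m τ = k * m' (f τ)) : mass m S = k * mass m' T := by
  classical
  rw [mass, mass, Finset.mul_sum]
  refine Finset.sum_nbij f (fun τ hτ => ?_) ?_ (fun τ hτ => ?_) fun τ hτ => ?_
  · exact (Finset.mem_filter_univ _).2 (hf.mapsTo ((Finset.mem_filter_univ τ).1 hτ))
  · exact hf.injOn.mono fun τ hτ => (Finset.mem_filter_univ τ).1 hτ
  · obtain ⟨τ', hτ', rfl⟩ := hf.surjOn ((Finset.mem_filter_univ τ).1 hτ)
    exact ⟨τ', (Finset.mem_filter_univ τ').2 hτ', rfl⟩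
  · exact h τ ((Finset.mem_filter_univ τ).1 hτ)

theorem IsLocallyGibbs.exists_mass_inter_cyl {m : (A → χ) → ℝ} (hm : IsLocallyGibbs G M A C m)
    (hS : Shields G A B C) (η : V → χ) :
    ∃ k : ℝ, 0 ≤ k ∧ ∀ P : Set (B → χ),
      mass m (Finset.restrict₂ (π := fun _ => χ) hS.subset ⁻¹' P ∩ cyl A Cᶜ η) =
        k * weightOf G M B (P ∩ cyl B Cᶜ η) := by
  obtain ⟨k, hk, hmk⟩ := hm η
  obtain ⟨ρ, hρ, hwρ⟩ := hS.exists_weight_eq_mul M η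
  have hbij := bijOn_restrict₂_cyl hS.subset hS.inner_subset η
  refine ⟨k * ρ, mul_nonneg hk hρ, fun P => ?_⟩
  have hbijP : Set.BijOn (Finset.restrict₂ (π := fun _ => χ) hS.subset)
      (Finset.restrict₂ (π := fun _ => χ) hS.subset ⁻¹' P ∩ cyl A Cᶜ η) (P ∩ cyl B Cᶜ η) := by
    refine ⟨fun τ hτ => ⟨hτ.1, hbij.mapsTo hτ.2⟩, hbij.injOn.mono Set.inter_subset_right, ?_⟩
    rintro τ ⟨hP, hη⟩
    obtain ⟨τ', hτ', rfl⟩ := hbij.surjOn hη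
    exact ⟨τ', ⟨hP, hτ'⟩, rfl⟩
  exact mass_eq_mul_mass_of_bijOn hbijP fun τ hτ => by rw [hmk τ hτ.2, hwρ τ hτ.2, mul_assoc]

theorem IsLocallyGibbs.mul_mass_le_mul_mass {m : (A → χ) → ℝ} (hm : IsLocallyGibbs G M A C m)
    (hS : Shields G A B C) {P Q : Set (B → χ)} {a b : ℝ}
    (h : ∀ η, a * weightOf G M B (P ∩ cyl B Cᶜ η) ≤ b * weightOf G M B (Q ∩ cyl B Cᶜ η))
    {E : Set V} (hE : E ⊆ Cᶜ) (σ : V → χ) :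
    a * mass m (Finset.restrict₂ (π := fun _ => χ) hS.subset ⁻¹' P ∩ cyl A E σ) ≤
      b * mass m (Finset.restrict₂ (π := fun _ => χ) hS.subset ⁻¹' Q ∩ cyl A E σ) := by
  classical
  rw [mass_eq_sum_mass_inter_cyl m (_ ∩ _) C σ, mass_eq_sum_mass_inter_cyl m (_ ∩ _) C σ,
    Finset.mul_sum, Finset.mul_sum]
  refine Finset.sum_le_sum fun ζ _ => ?_
  set η := Function.extend Subtype.val ζ σ
  rw [Set.inter_assoc, Set.inter_assoc]
  rcases cyl_inter_cyl_eq_or_eq_empty A hE σ η with hη | hη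
  · obtain ⟨k, hk, hmk⟩ := hm.exists_mass_inter_cyl hS η
    rw [hη, hmk, hmk, mul_left_comm, mul_left_comm b]
    exact mul_le_mul_of_nonneg_left (h η) hk
  · simp [hη]

theorem weightOf_nonneg (G : SimpleGraph V) (M : Model χ) (A : Finset V) (S : Set (A → χ)) :
    0 ≤ weightOf G M A S := mass_nonneg (weight_nonneg G M A) S

theorem weightOf_singleton (G : SimpleGraph V) (M : Model χ) (A : Finset V) (τ : A → χ) :
    weightOf G M A {τ} = weight G M A τ := mass_singleton _ τ

theorem weightOf_inter_eq_zero {S T : Set (A → χ)} (hT : weightOf G M A T = 0) :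
    weightOf G M A (S ∩ T) = 0 :=
  le_antisymm (hT ▸ mass_mono (weight_nonneg G M A) Set.inter_subset_right)
    (weightOf_nonneg G M A _)

theorem finCondProb_mul_weightOf (S T : Set (A → χ)) :
    finCondProb G M A S T * weightOf G M A T = weightOf G M A (S ∩ T) :=
  div_mul_cancel_of_imp weightOf_inter_eq_zero

theorem IsLocallyGibbs.mass_inter_mem_Icc {m : (A → χ) → ℝ} (hm : IsLocallyGibbs G M A C m)
    (hS : Shields G A B C) {X F : Set V} (hX : ∀ v ∈ A, v ∈ X → v ∈ B) {ξ σ : V → χ} {a b : ℝ}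
    (hab : ∀ η, weightOf G M B (cyl B F σ ∩ cyl B Cᶜ η) ≠ 0 →
      finCondProb G M B (cyl B X ξ) (cyl B F σ ∩ cyl B Cᶜ η) ∈ Set.Icc a b) :
    mass m (cyl A X ξ ∩ cyl A F σ) ∈ Set.Icc (a * mass m (cyl A F σ)) (b * mass m (cyl A F σ)) := by
  set P := cyl B X ξ
  set T := cyl B F σ
  have hF := cyl_eq_preimage_restrict₂_inter hS.subset F σ
  have hXF : cyl A X ξ ∩ cyl A F σ =
      Finset.restrict₂ (π := fun _ => χ) hS.subset ⁻¹' (P ∩ T) ∩ cyl A (F \ B) σ := by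
    rw [hF, ← Set.inter_assoc, Set.preimage_inter, preimage_restrict₂_cyl hS.subset hX]
  have hle : ∀ η, a * weightOf G M B (T ∩ cyl B Cᶜ η) ≤ weightOf G M B (P ∩ T ∩ cyl B Cᶜ η) ∧
      weightOf G M B (P ∩ T ∩ cyl B Cᶜ η) ≤ b * weightOf G M B (T ∩ cyl B Cᶜ η) := by
    intro η
    rw [Set.inter_assoc, ← finCondProb_mul_weightOf P]
    rcases eq_or_ne (weightOf G M B (T ∩ cyl B Cᶜ η)) 0 with h0 | h0
    · simp only [h0, mul_zero, le_refl, and_self]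
    · exact ⟨mul_le_mul_of_nonneg_right (hab η h0).1 (weightOf_nonneg G M B _),
        mul_le_mul_of_nonneg_right (hab η h0).2 (weightOf_nonneg G M B _)⟩
  have hE : F \ B ⊆ Cᶜ := fun v hv hC => hv.2 (hS.inner_subset hC)
  rw [hXF, hF, ← one_mul (mass m (_ ⁻¹' (P ∩ T) ∩ _))]
  exact ⟨hm.mul_mass_le_mul_mass hS (fun η => (one_mul (weightOf G M B _)).symm ▸ (hle η).1) hE σ,
    hm.mul_mass_le_mul_mass hS (fun η => (one_mul (weightOf G M B _)).symm ▸ (hle η).2) hE σ⟩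

end LocalGibbs

section Mixing

variable {V χ : Type*} {G : SimpleGraph V} {M : Model χ} {s : χ}

theorem weight_const_ne_zero (G : SimpleGraph V) (hs : ∀ t, M.H t s ≠ ⊤) (A : Finset V) :
    weight G M A (fun _ => s) ≠ 0 :=
  (weight_restrict_ne_zero_iff G M A fun _ => s).2 fun _ _ _ _ _ => hs s

open Classical in
theorem weight_restrict_piecewise_ne_zero (hs : ∀ t, M.H t s ≠ ⊤) (X : Finset V) {B : Finset V}
    {σ : V → χ} (hσ : weight G M B (B.restrict σ) ≠ 0) :
    weight G M B (B.restrict (X.piecewise (fun _ => s) σ)) ≠ 0 := by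
  rw [weight_restrict_ne_zero_iff] at hσ ⊢
  intro u hu v hv huv
  by_cases hvX : v ∈ X
  · simpa [hvX] using hs _
  · by_cases huX : u ∈ X
    · simpa [huX, M.symm s] using hs _
    · simpa [huX, hvX] using hσ u hu v hv huv

theorem boundaryEvent_eq_cyl_inter_cyl {B : Finset V} {F Y : Set V}
    (hF : ∀ v ∈ B, v ∈ F ↔ v ∈ Y) (σ η : V → χ) :
    boundaryEvent G B Y σ η = cyl B F σ ∩ cyl B (innerSites G B)ᶜ η := by
  have hbd : ∀ v ∈ B, v ∈ (innerSites G B)ᶜ ↔ v ∈ boundary G (B : Set V) := fun v hv => by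
    simp [innerSites, hv]
  rw [cyl_congr hF, cyl_congr hbd]
  rfl

variable [Fintype χ]

theorem weightOf_pos_of_const_mem (G : SimpleGraph V) (hs : ∀ t, M.H t s ≠ ⊤) {A : Finset V}
    {S : Set (A → χ)} (hS : (fun _ => s) ∈ S) : 0 < weightOf G M A S :=
  mass_pos (weight_nonneg G M A) hS (weight_const_ne_zero G hs A)

theorem weightOf_cyl_const_pos (G : SimpleGraph V) (hs : ∀ t, M.H t s ≠ ⊤) (A : Finset V)
    (F : Set V) : 0 < weightOf G M A (cyl A F fun _ => s) :=
  weightOf_pos_of_const_mem G hs fun _ _ => rfl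

/-- The conditional probability of `S` given `T` under the normalization of `m`, as in
`finCondProb`; it is zero if `T` has mass zero. -/
noncomputable def condMass {A : Finset V} (m : (A → χ) → ℝ) (S T : Set (A → χ)) : ℝ :=
  mass m (S ∩ T) / mass m T

/-- The conditional probability of `ξ` on `X` given the spin `s` on `Y`, as a bulk quantity: `p` is
approximated by the conditional probabilities in all systems which contain a large finite set `B`
and are Gibbsian inside `B`, given the spin `s` on any set `F` that looks like `Y` inside `B`. -/
def HasBulkCondProb (G : SimpleGraph V) (M : Model χ) (X : Finset V) (ξ : V → χ) (Y : Set V)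
    (s : χ) (p : ℝ) : Prop :=
  ∀ ε > 0, ∃ B : Finset V, ∀ A : Finset V, B ⊆ A → ∀ m : (A → χ) → ℝ,
    IsLocallyGibbs G M A (innerSites G B) m → ∀ F : Set V, (∀ v ∈ B, v ∈ F ↔ v ∈ Y) →
      0 < mass m (cyl A F fun _ => s) →
        |condMass m (cyl A X ξ) (cyl A F fun _ => s) - p| ≤ ε

theorem IsLocallyGibbs.abs_condMass_sub_le {A B : Finset V} {C : Set V} {m : (A → χ) → ℝ}
    (hm : IsLocallyGibbs G M A C m) (hS : Shields G A B C) {X F : Set V}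
    (hX : ∀ v ∈ A, v ∈ X → v ∈ B) {ξ σ : V → χ} {q δ : ℝ}
    (hq : ∀ η, weightOf G M B (cyl B F σ ∩ cyl B Cᶜ η) ≠ 0 →
      |finCondProb G M B (cyl B X ξ) (cyl B F σ ∩ cyl B Cᶜ η) - q| ≤ δ)
    (hF : 0 < mass m (cyl A F σ)) : |condMass m (cyl A X ξ) (cyl A F σ) - q| ≤ δ := by
  have h := hm.mass_inter_mem_Icc hS hX (a := q - δ) (b := q + δ) fun η hη =>
    ⟨by linarith [(abs_le.1 (hq η hη)).1], by linarith [(abs_le.1 (hq η hη)).2]⟩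
  have hlow : q - δ ≤ condMass m (cyl A X ξ) (cyl A F σ) := (le_div_iff₀ hF).2 h.1
  have hup : condMass m (cyl A X ξ) (cyl A F σ) ≤ q + δ := (div_le_iff₀ hF).2 h.2
  exact abs_le.2 ⟨by linarith, by linarith⟩

theorem StrongSpatialMixing.exists_abs_condMass_sub_le (hSSM : StrongSpatialMixing G M)
    (hG : ∀ v, (G.neighborSet v).Finite) (hs : ∀ t, M.H t s ≠ ⊤) (X : Finset V) (Y : Set V)
    (ξ : V → χ) :
    ∃ R q : ℕ → ℝ, Tendsto R atTop (𝓝 0) ∧ ∀ r, 1 ≤ r → ∃ B : Finset V, ∀ A : Finset V, B ⊆ A →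
      ∀ m : (A → χ) → ℝ, IsLocallyGibbs G M A (innerSites G B) m →
        ∀ F : Set V, (∀ v ∈ B, v ∈ F ↔ v ∈ Y) → 0 < mass m (cyl A F fun _ => s) →
          |condMass m (cyl A X ξ) (cyl A F fun _ => s) - q r| ≤ R r := by
  obtain ⟨R, hR, hmix⟩ := hSSM X Y
  let B r := (ball_finite G hG X.finite_toSet r).toFinset
  have hB : ∀ r, (B r : Set V) = ball G X r := fun r => Set.Finite.coe_toFinset _
  refine ⟨R, fun r => finCondProb G M (B r) (cyl (B r) X ξ)
    (boundaryEvent G (B r) Y (fun _ => s) fun _ => s), hR, fun r hr => ⟨B r, ?_⟩⟩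
  intro A hBA m hm F hF hpos
  have hXB : ∀ v ∈ A, v ∈ (X : Set V) → v ∈ B r := fun v _ hv => by
    rw [← Finset.mem_coe, hB]
    exact ⟨v, hv, by simp⟩
  refine hm.abs_condMass_sub_le (shields_innerSites G hBA) hXB (fun η hη => ?_) hpos
  rw [← boundaryEvent_eq_cyl_inter_cyl hF] at hη ⊢
  have hconst : (fun _ => s) ∈ boundaryEvent G (B r) Y (fun _ => s) fun _ => s :=
    ⟨fun _ _ => rfl, fun _ _ => rfl⟩
  exact hmix r hr (B r) (hB r) ξ _ η _ hη (weightOf_pos_of_const_mem G hs hconst).ne'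

theorem exists_forall_abs_sub_le_of_eventually {ι : Type*} {l : Filter ι} [l.NeBot] {x : ι → ℝ}
    {q R : ℕ → ℝ} (hR : Tendsto R atTop (𝓝 0))
    (h : ∀ r, 1 ≤ r → ∀ᶠ i in l, |x i - q r| ≤ R r) :
    ∃ p, ∀ r, 1 ≤ r → |p - q r| ≤ R r := by
  have hcauchy : Cauchy (map x l) := by
    refine Metric.cauchy_iff.2 ⟨inferInstance, fun ε hε => ?_⟩
    obtain ⟨r, hr1, hr⟩ :=
      ((eventually_ge_atTop 1).and (hR.eventually (gt_mem_nhds (half_pos hε)))).exists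
    refine ⟨x '' {i | |x i - q r| ≤ R r}, image_mem_map (h r hr1), ?_⟩
    rintro _ ⟨i, hi, rfl⟩ _ ⟨j, hj, rfl⟩
    rw [Real.dist_eq]
    calc |x i - x j| ≤ |x i - q r| + |q r - x j| := abs_sub_le _ _ _
      _ ≤ R r + R r := add_le_add hi (abs_sub_comm (x j) _ ▸ hj)
      _ < ε := by linarith
  obtain ⟨p, hp⟩ := CompleteSpace.complete hcauchy
  have hxp : Tendsto x l (𝓝 p) := hp
  exact ⟨p, fun r hr => le_of_tendsto (hxp.sub_const _).abs (h r hr)⟩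

theorem StrongSpatialMixing.exists_hasBulkCondProb (hSSM : StrongSpatialMixing G M)
    (hG : ∀ v, (G.neighborSet v).Finite) (hs : ∀ t, M.H t s ≠ ⊤) (X : Finset V) (ξ : V → χ)
    (Y : Set V) : ∃ p, HasBulkCondProb G M X ξ Y s p := by
  obtain ⟨R, q, hR, hB⟩ := hSSM.exists_abs_condMass_sub_le hG hs X Y ξ
  obtain ⟨p, hp⟩ := exists_forall_abs_sub_le_of_eventually (l := atTop)
    (x := fun A => finCondProb G M A (cyl A X ξ) (cyl A Y fun _ => s)) hR fun r hr => by
      obtain ⟨B, h⟩ := hB r hr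
      filter_upwards [eventually_ge_atTop B] with A hBA
      exact h A hBA _ (isLocallyGibbs_weight G M A _) Y (fun _ _ => Iff.rfl)
        (weightOf_cyl_const_pos G hs A Y)
  refine ⟨p, fun ε hε => ?_⟩
  obtain ⟨r, hr1, hr⟩ :=
    ((eventually_ge_atTop 1).and (hR.eventually (gt_mem_nhds (half_pos hε)))).exists
  obtain ⟨B, h⟩ := hB r hr1
  refine ⟨B, fun A hBA m hm F hF hpos => ?_⟩
  set x := condMass m (cyl A X ξ) (cyl A F fun _ => s)
  calc |x - p| ≤ |x - q r| + |q r - p| := abs_sub_le _ _ _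
    _ ≤ R r + R r := add_le_add (h A hBA m hm F hF hpos) (abs_sub_comm p _ ▸ hp r hr1)
    _ ≤ ε := by linarith

theorem finCondProb_le_one (G : SimpleGraph V) (M : Model χ) (A : Finset V) (S T : Set (A → χ)) :
    finCondProb G M A S T ≤ 1 :=
  div_le_one_of_le₀ (mass_mono (weight_nonneg G M A) Set.inter_subset_right)
    (weightOf_nonneg G M A T)

theorem exists_pos_le_finCondProb (G : SimpleGraph V) (M : Model χ) (B : Finset V) :
    ∃ c : ℝ, 0 < c ∧ ∀ S T : Set (B → χ), 0 < weightOf G M B (S ∩ T) →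
      c ≤ finCondProb G M B S T := by
  classical
  let f : Set (B → χ) × Set (B → χ) → ℝ := fun p =>
    if 0 < weightOf G M B (p.1 ∩ p.2) then finCondProb G M B p.1 p.2 else 1
  have hf : ∀ p, 0 < f p := by
    intro p
    simp only [f]
    split_ifs with h
    · exact div_pos h (h.trans_le (mass_mono (weight_nonneg G M B) Set.inter_subset_right))
    · exact one_pos
  obtain ⟨p, hp⟩ := Finite.exists_min f
  exact ⟨f p, hf p, fun S T h => (hp (S, T)).trans_eq (by simp [f, h])⟩

theorem weightOf_cyl_const_inter_pos (hs : ∀ t, M.H t s ≠ ⊤) {A X : Finset V} {F : Set V}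
    {η : V → χ}
    (h : weightOf G M A (cyl A F (fun _ => s) ∩ cyl A (X : Set V)ᶜ η) ≠ 0) :
    0 < weightOf G M A
      (cyl A X (fun _ => s) ∩ (cyl A F (fun _ => s) ∩ cyl A (X : Set V)ᶜ η)) := by
  classical
  obtain ⟨τ, hτ, hw⟩ := exists_of_mass_ne_zero h
  obtain ⟨σ, rfl⟩ : ∃ σ : V → χ, A.restrict σ = τ := ⟨_, restrict_extend A τ η⟩
  rw [Set.mem_inter_iff, restrict_mem_cyl_iff, restrict_mem_cyl_iff] at hτ
  refine mass_pos (weight_nonneg G M A) ?_ (weight_restrict_piecewise_ne_zero hs X hw)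
  simp only [Set.mem_inter_iff, restrict_mem_cyl_iff]
  refine ⟨fun v _ hv => X.piecewise_eq_of_mem _ _ hv, fun v hvA hv => ?_, fun v hvA hv => ?_⟩
  · by_cases hvX : v ∈ X
    · exact X.piecewise_eq_of_mem _ _ hvX
    · rw [X.piecewise_eq_of_notMem _ _ hvX, hτ.1 v hvA hv]
  · rw [X.piecewise_eq_of_notMem _ _ hv, hτ.2 v hvA hv]

theorem exists_pos_le_condMass (hG : ∀ v, (G.neighborSet v).Finite) (hs : ∀ t, M.H t s ≠ ⊤)
    (X : Finset V) :
    ∃ c : ℝ, 0 < c ∧ ∀ (A : Finset V) (m : (A → χ) → ℝ), IsLocallyGibbs G M A X m →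
      ∀ F : Set V, 0 < mass m (cyl A F fun _ => s) →
        c ≤ condMass m (cyl A X fun _ => s) (cyl A F fun _ => s) := by
  classical
  let N : Finset V := X ∪ X.biUnion fun v => (hG v).toFinset
  choose c hc0 hc using exists_pos_le_finCondProb (χ := χ) G M
  -- Only the finitely many systems `N ∩ A` enter the bound, so that it is uniform in `A`.
  obtain ⟨B₀, _, hB₀⟩ := Finset.exists_min_image N.powerset c ⟨N, Finset.mem_powerset_self N⟩
  refine ⟨c B₀, hc0 B₀, fun A m hm F hF => (le_div_iff₀ hF).2 ?_⟩
  have hshields : Shields G A (N ∩ A) (X ∩ A : Finset V) :=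
    { subset := Finset.inter_subset_right
      inner_subset := Finset.coe_subset.2
        (Finset.inter_subset_inter_right Finset.subset_union_left)
      mem_of_adj := fun v hv u hu hvu => Finset.mem_inter.2 ⟨Finset.mem_union_right _
        (Finset.mem_biUnion.2 ⟨v, (Finset.mem_inter.1 hv).1, (hG v).mem_toFinset.2 hvu⟩), hu⟩ }
  refine ((hm.mono (Finset.coe_subset.2 Finset.inter_subset_left)).mass_inter_mem_Icc hshields
    (b := 1) (fun v hvA hvX => Finset.mem_inter.2 ⟨Finset.mem_union_left _ hvX, hvA⟩)
    fun η hη => ⟨?_, finCondProb_le_one G M _ _ _⟩).1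
  have hcompl : ∀ v ∈ N ∩ A, v ∈ ((X ∩ A : Finset V) : Set V)ᶜ ↔ v ∈ (X : Set V)ᶜ := by
    simp +contextual
  rw [cyl_congr hcompl] at hη ⊢
  exact (hB₀ _ (Finset.mem_powerset.2 Finset.inter_subset_left)).trans
    (hc _ _ _ (weightOf_cyl_const_inter_pos hs hη))

theorem HasBulkCondProb.pos (hG : ∀ v, (G.neighborSet v).Finite) (hs : ∀ t, M.H t s ≠ ⊤)
    {X : Finset V} {Y : Set V} {p : ℝ} (hp : HasBulkCondProb G M X (fun _ => s) Y s p) :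
    0 < p := by
  obtain ⟨c, hc, hcle⟩ := exists_pos_le_condMass hG hs X
  obtain ⟨B, hB⟩ := hp (c / 2) (half_pos hc)
  have hpos := weightOf_cyl_const_pos G hs B Y
  have hclose := abs_le.1 (hB B subset_rfl _ (isLocallyGibbs_weight G M B _) Y
    (fun _ _ => Iff.rfl) hpos)
  linarith [hcle B _ (isLocallyGibbs_weight G M B _) Y hpos, hclose.2]

end Mixing

section GibbsMeasures

variable {V χ : Type*} {G : SimpleGraph V} {M : Model χ} {s : χ}

/-- The event that the spins in `F` agree with `σ`, for configurations on all of `V`. -/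
def pinned (F : Set V) (σ : V → χ) : Set (V → χ) :=
  {ω | ∀ v ∈ F, ω v = σ v}

theorem isClopen_pinned [TopologicalSpace χ] [DiscreteTopology χ] (F : Finset V) (σ : V → χ) :
    IsClopen (pinned (F : Set V) σ) := by
  have hpinned : pinned (F : Set V) σ = ⋂ v ∈ F, (fun ω : V → χ => ω v) ⁻¹' {σ v} := by
    ext ω
    simp [pinned]
  rw [hpinned]
  exact F.finite_toSet.isClopen_biInter fun v _ =>
    (isClopen_discrete _).preimage (continuous_apply v)

theorem preimage_restrict_cyl {A : Finset V} {F : Set V} (hF : F ⊆ A) (σ : V → χ) :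
    A.restrict ⁻¹' cyl A F σ = pinned F σ :=
  Set.ext fun _ => restrict_mem_cyl_iff.trans
    ⟨fun h v hv => h v (hF hv) hv, fun h v _ hv => h v hv⟩

theorem preimage_restrict_singleton (A : Finset V) (σ : V → χ) :
    (A.restrict ⁻¹' ({A.restrict σ} : Set (A → χ)) : Set (V → χ)) = pinned A σ :=
  Set.ext fun _ => funext_iff.trans ⟨fun h v hv => h ⟨v, hv⟩, fun h v => h v v.2⟩

theorem cyl_inter_cyl_compl (A : Finset V) (C : Set V) (σ : V → χ) :
    cyl A C σ ∩ cyl A Cᶜ σ = {A.restrict σ} := by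
  rw [cyl_inter_cyl, Set.union_compl_self]
  exact Set.ext fun τ => ⟨fun h => funext fun v => h v trivial, fun h v _ => congrFun h v⟩

theorem cyl_eq_cyl_of_mem {A : Finset V} {F : Set V} {σ η : V → χ}
    (h : A.restrict σ ∈ cyl A F η) : cyl A F σ = cyl A F η :=
  Set.ext fun _ => forall₂_congr fun v hv => by rw [← h v hv]; rfl

variable [MeasurableSpace χ]

/-- The law of the spins in `A` under `μ`, as a function on configurations. -/
noncomputable def marginal (μ : Measure (V → χ)) (A : Finset V) (τ : A → χ) : ℝ :=
  μ.real (A.restrict ⁻¹' {τ})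

theorem marginal_nonneg (μ : Measure (V → χ)) (A : Finset V) (τ : A → χ) :
    0 ≤ marginal μ A τ := measureReal_nonneg

variable [Fintype χ] [DiscreteMeasurableSpace χ]

theorem mass_marginal (μ : Measure (V → χ)) [IsFiniteMeasure μ] (A : Finset V) (S : Set (A → χ)) :
    mass (marginal μ A) S = μ.real (A.restrict ⁻¹' S) := by
  classical
  have hmap : ∀ S : Set (A → χ), μ.real (A.restrict ⁻¹' S) = (μ.map A.restrict).real S :=
    fun S => (map_measureReal_apply (Finset.measurable_restrict A) S.toFinite.measurableSet).symm
  simp only [mass, marginal, hmap, sum_measureReal_singleton]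
  rw [Finset.coe_filter_univ]
  rfl

theorem condMass_marginal (μ : Measure (V → χ)) [IsFiniteMeasure μ] (A : Finset V)
    (S T : Set (A → χ)) :
    condMass (marginal μ A) S T =
      (ProbabilityTheory.cond μ (A.restrict ⁻¹' T)).real (A.restrict ⁻¹' S) := by
  rw [condMass, mass_marginal, mass_marginal, measureReal_def (ProbabilityTheory.cond _ _),
    ProbabilityTheory.cond_apply (Finset.measurable_restrict A T.toFinite.measurableSet),
    ENNReal.toReal_mul, ENNReal.toReal_inv, inv_mul_eq_div, Set.inter_comm]
  rfl

theorem IsGibbsMeasure.marginal_restrict {μ : Measure (V → χ)} (hμ : IsGibbsMeasure G M μ)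
    {Λ Δ : Finset V} (hΛΔ : Λ ⊆ Δ) (hΛ : ∀ v ∈ Λ, ∀ u, G.Adj v u → u ∈ Δ) (σ : V → χ) :
    marginal μ Δ (Δ.restrict σ) = finCondProb G M Δ (cyl Δ Λ σ) (cyl Δ (Λ : Set V)ᶜ σ) *
      mass (marginal μ Δ) (cyl Δ (Λ : Set V)ᶜ σ) := by
  have := hμ.isProbabilityMeasure
  have hcompl : Δ.restrict ⁻¹' cyl Δ (Λ : Set V)ᶜ σ = {ω | ∀ v ∈ Δ, v ∉ Λ → ω v = σ v} :=
    Set.ext fun _ => restrict_mem_cyl_iff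
  rw [marginal, preimage_restrict_singleton, mass_marginal, hcompl]
  exact hμ.dlr Λ Δ hΛΔ hΛ σ

theorem IsGibbsMeasure.isLocallyGibbs {μ : Measure (V → χ)} (hμ : IsGibbsMeasure G M μ)
    {A : Finset V} {C : Set V} (hCA : C ⊆ A) (hC : ∀ v ∈ C, ∀ u, G.Adj v u → u ∈ A) :
    IsLocallyGibbs G M A C (marginal μ A) := by
  lift C to Finset V using A.finite_toSet.subset hCA
  intro η
  refine ⟨mass (marginal μ A) (cyl A (C : Set V)ᶜ η) / weightOf G M A (cyl A (C : Set V)ᶜ η),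
    div_nonneg (mass_nonneg (marginal_nonneg μ A) _) (weightOf_nonneg G M A _), fun τ hτ => ?_⟩
  obtain ⟨σ, rfl⟩ : ∃ σ : V → χ, A.restrict σ = τ := ⟨_, restrict_extend A τ η⟩
  rw [hμ.marginal_restrict (Finset.coe_subset.1 hCA) hC, finCondProb, cyl_inter_cyl_compl,
    cyl_eq_cyl_of_mem hτ, weightOf_singleton]
  ring

theorem IsGibbsMeasure.isLocallyGibbs_innerSites {μ : Measure (V → χ)}
    (hμ : IsGibbsMeasure G M μ) {A B : Finset V} (hBA : B ⊆ A) :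
    IsLocallyGibbs G M A (innerSites G B) (marginal μ A) :=
  hμ.isLocallyGibbs (fun _ hv => hBA hv.1) fun _ hv u hvu =>
    hBA (by_contra fun hu => hv.2 ⟨hv.1, u, hvu, hu⟩)

theorem IsGibbsMeasure.measureReal_pinned_const_pos (hG : ∀ v, (G.neighborSet v).Finite)
    (hs : ∀ t, M.H t s ≠ ⊤) {μ : Measure (V → χ)} (hμ : IsGibbsMeasure G M μ) (F : Finset V) :
    0 < μ.real (pinned (F : Set V) fun _ => s) := by
  classical
  have := hμ.isProbabilityMeasure
  obtain ⟨c, hc, hcle⟩ := exists_pos_le_condMass hG hs F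
  let A : Finset V := F ∪ F.biUnion fun v => (hG v).toFinset
  have hFA : F ⊆ A := Finset.subset_union_left
  have hloc : IsLocallyGibbs G M A F (marginal μ A) := hμ.isLocallyGibbs
    (Finset.coe_subset.2 hFA) fun v hv u hvu => Finset.mem_union_right _
      (Finset.mem_biUnion.2 ⟨v, hv, (hG v).mem_toFinset.2 hvu⟩)
  have huniv : A.restrict ⁻¹' cyl A ∅ (fun _ => s) = (Set.univ : Set (V → χ)) :=
    (preimage_restrict_cyl (Set.empty_subset _) _).trans
      (Set.eq_univ_of_forall fun _ _ hv => absurd hv (Set.notMem_empty _))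
  have hle := hcle A _ hloc ∅ (by simp [mass_marginal, huniv])
  rw [condMass_marginal, huniv, ProbabilityTheory.cond_univ,
    preimage_restrict_cyl (Finset.coe_subset.2 hFA)] at hle
  exact hc.trans_le hle

theorem HasBulkCondProb.exists_abs_cond_sub_le (hG : ∀ v, (G.neighborSet v).Finite)
    (hs : ∀ t, M.H t s ≠ ⊤) {X : Finset V} {ξ : V → χ} {Y : Set V} {p : ℝ}
    (hp : HasBulkCondProb G M X ξ Y s p) {ε : ℝ} (hε : 0 < ε) :
    ∃ B : Finset V, ∀ μ : Measure (V → χ), IsGibbsMeasure G M μ →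
      ∀ F : Finset V, (∀ v ∈ B, v ∈ F ↔ v ∈ Y) →
        |(ProbabilityTheory.cond μ (pinned F fun _ => s)).real (pinned X ξ) - p| ≤ ε := by
  classical
  obtain ⟨B, hB⟩ := hp ε hε
  refine ⟨B, fun μ hμ F hF => ?_⟩
  have := hμ.isProbabilityMeasure
  let A : Finset V := B ∪ (X ∪ F)
  have hXA : (X : Set V) ⊆ A := Finset.coe_subset.2
    (Finset.subset_union_left.trans Finset.subset_union_right)
  have hFA : (F : Set V) ⊆ A := Finset.coe_subset.2
    (Finset.subset_union_right.trans Finset.subset_union_right)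
  have hBA : B ⊆ A := Finset.subset_union_left
  have hpos : 0 < mass (marginal μ A) (cyl A F fun _ => s) := by
    rw [mass_marginal, preimage_restrict_cyl hFA]
    exact hμ.measureReal_pinned_const_pos hG hs F
  have hclose := hB A hBA _ (hμ.isLocallyGibbs_innerSites hBA) F hF hpos
  rwa [condMass_marginal, preimage_restrict_cyl hXA, preimage_restrict_cyl hFA] at hclose

theorem HasBulkCondProb.hasCondProb (hG : ∀ v, (G.neighborSet v).Finite)
    (hs : ∀ t, M.H t s ≠ ⊤) {X : Finset V} {ξ : V → χ} {Y : Set V} {p : ℝ}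
    (hp : HasBulkCondProb G M X ξ Y s p) {μ : Measure (V → χ)} (hμ : IsGibbsMeasure G M μ) :
    HasCondProb μ (pinned X ξ) Y s p := by
  classical
  refine Metric.nhds_basis_closedBall.tendsto_right_iff.2 fun ε hε => ?_
  obtain ⟨B, hB⟩ := hp.exists_abs_cond_sub_le hG hs hε
  filter_upwards [eventually_ge_atTop (B.subtype (· ∈ Y))] with F hF
  have hFY : ∀ v ∈ B, v ∈ F.map (Function.Embedding.subtype _) ↔ v ∈ Y := fun v hv => by
    simp only [Finset.mem_map, Function.Embedding.subtype_apply, Subtype.exists,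
      exists_and_right, exists_eq_right]
    exact ⟨fun h => h.1, fun h => ⟨h, hF (by simpa using hv)⟩⟩
  have hpinned : {ω : V → χ | ∀ v ∈ F, ω (v : V) = s} =
      pinned (F.map (Function.Embedding.subtype _) : Finset V) fun _ => s := by
    ext ω
    simp [pinned]
  rw [hpinned]
  exact hB μ hμ _ hFY

theorem IsGibbsMeasure.unique (hSSM : StrongSpatialMixing G M)
    (hG : ∀ v, (G.neighborSet v).Finite) (hs : ∀ t, M.H t s ≠ ⊤)
    {μ ν : Measure (V → χ)} (hμ : IsGibbsMeasure G M μ) (hν : IsGibbsMeasure G M ν) : μ = ν := by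
  have := hμ.isProbabilityMeasure
  have := hν.isProbabilityMeasure
  have hpinned : ∀ (X : Finset V) (ξ : V → χ), μ.real (pinned X ξ) = ν.real (pinned X ξ) := by
    intro X ξ
    obtain ⟨p, hp⟩ := hSSM.exists_hasBulkCondProb hG hs X ξ ∅
    have hlaw : ∀ ρ : Measure (V → χ), IsGibbsMeasure G M ρ → ρ.real (pinned X ξ) = p := by
      intro ρ hρ
      have := hρ.isProbabilityMeasure
      refine eq_of_forall_dist_le fun ε hε => ?_
      obtain ⟨B, hB⟩ := hp.exists_abs_cond_sub_le hG hs hε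
      simpa [pinned, Real.dist_eq] using hB ρ hρ ∅ (by simp)
    rw [hlaw μ hμ, hlaw ν hν]
  refine IsProjectiveLimit.unique (P := fun X => ν.map X.restrict) (fun X => ?_) fun X => rfl
  refine Measure.ext_of_singleton fun τ => ?_
  obtain ⟨σ, rfl⟩ : ∃ σ : V → χ, X.restrict σ = τ := by
    obtain ⟨η⟩ : Nonempty (V → χ) := ⟨fun _ => s⟩
    exact ⟨_, restrict_extend X τ η⟩
  rw [Measure.map_apply (Finset.measurable_restrict X) (measurableSet_singleton _),
    Measure.map_apply (Finset.measurable_restrict X) (measurableSet_singleton _),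
    preimage_restrict_singleton]
  exact (measureReal_eq_measureReal_iff).1 (hpinned X σ)

end GibbsMeasures

section Existence

variable {V χ : Type*} [Fintype χ] {G : SimpleGraph V} {M : Model χ} {s : χ}

theorem partitionFunction_pos (G : SimpleGraph V) (hs : ∀ t, M.H t s ≠ ⊤) (A : Finset V) :
    0 < partitionFunction G M A :=
  weightOf_pos_of_const_mem G hs (Set.mem_univ _)

theorem weightOf_cyl_eq_finCondProb_mul {A Δ Λ : Finset V} (hΔA : Δ ⊆ A) (hΛΔ : Λ ⊆ Δ)
    (hΛ : ∀ v ∈ Λ, ∀ u, G.Adj v u → u ∈ Δ) (σ : V → χ) :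
    weightOf G M A (cyl A Δ σ) = finCondProb G M Δ (cyl Δ Λ σ) (cyl Δ (Λ : Set V)ᶜ σ) *
      weightOf G M A (cyl A (Δ \ Λ) σ) := by
  have hshields : Shields G A Δ Λ := ⟨hΔA, Finset.coe_subset.2 hΛΔ, fun v hv u _ => hΛ v hv u⟩
  have hdiff : ∀ v ∈ Δ, v ∈ (Δ \ Λ : Set V) ↔ v ∈ (Λ : Set V)ᶜ := by simp +contextual
  have h := (isLocallyGibbs_weight G M A Λ).mass_inter_mem_Icc hshields
    (a := finCondProb G M Δ (cyl Δ Λ σ) (cyl Δ (Λ : Set V)ᶜ σ))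
    (b := finCondProb G M Δ (cyl Δ Λ σ) (cyl Δ (Λ : Set V)ᶜ σ))
    (X := Λ) (F := Δ \ Λ) (ξ := σ) (σ := σ) (fun v _ hv => hΛΔ hv) fun η hη => ?_
  · rw [cyl_inter_cyl, Set.union_sdiff_cancel (Finset.coe_subset.2 hΛΔ), Set.Icc_self] at h
    exact h
  · rw [cyl_congr hdiff] at hη ⊢
    obtain ⟨τ, hτ, -⟩ := exists_of_mass_ne_zero hη
    obtain ⟨ω, rfl⟩ : ∃ ω : V → χ, Δ.restrict ω = τ := ⟨_, restrict_extend Δ τ η⟩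
    rw [← cyl_eq_cyl_of_mem hτ.2, cyl_eq_cyl_of_mem hτ.1, Set.inter_self, Set.Icc_self]
    exact Set.mem_singleton _

variable [MeasurableSpace χ] [DiscreteMeasurableSpace χ]

/-- The finite Gibbs measure on `A`, with the spins outside of `A` equal to `s`, as a measure on
all configurations. -/
noncomputable def finiteGibbsMeasure (G : SimpleGraph V) (M : Model χ) (s : χ) (A : Finset V) :
    Measure (V → χ) :=
  open Classical in ∑ τ : A → χ, ENNReal.ofReal (weight G M A τ / partitionFunction G M A) •
    Measure.dirac (Function.extend Subtype.val τ fun _ => s)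

theorem finiteGibbsMeasure_preimage_restrict (G : SimpleGraph V) (M : Model χ) (s : χ)
    (A : Finset V) (S : Set (A → χ)) :
    finiteGibbsMeasure G M s A (A.restrict ⁻¹' S) =
      ENNReal.ofReal (weightOf G M A S / partitionFunction G M A) := by
  classical
  have hS : MeasurableSet (A.restrict ⁻¹' S : Set (V → χ)) :=
    Finset.measurable_restrict A S.toFinite.measurableSet
  have hnonneg : ∀ τ, 0 ≤ weight G M A τ / partitionFunction G M A := fun τ =>
    div_nonneg (weight_nonneg G M A τ) (weightOf_nonneg G M A _)
  rw [finiteGibbsMeasure, weightOf, Finset.sum_div,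
    ENNReal.ofReal_sum_of_nonneg fun τ _ => hnonneg τ, Finset.sum_filter]
  simp only [Measure.finsetSum_apply, Measure.smul_apply, Measure.dirac_apply' _ hS, smul_eq_mul]
  refine Finset.sum_congr rfl fun τ _ => ?_
  by_cases h : τ ∈ S <;> simp [h, restrict_extend]

theorem finiteGibbsMeasure_real_preimage_restrict (G : SimpleGraph V) (M : Model χ) (s : χ)
    (A : Finset V) (S : Set (A → χ)) :
    (finiteGibbsMeasure G M s A).real (A.restrict ⁻¹' S) =
      weightOf G M A S / partitionFunction G M A := by
  rw [measureReal_def, finiteGibbsMeasure_preimage_restrict, ENNReal.toReal_ofReal]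
  exact div_nonneg (weightOf_nonneg G M A _) (weightOf_nonneg G M A _)

theorem isProbabilityMeasure_finiteGibbsMeasure (G : SimpleGraph V) (hs : ∀ t, M.H t s ≠ ⊤)
    (A : Finset V) : IsProbabilityMeasure (finiteGibbsMeasure G M s A) := by
  refine ⟨?_⟩
  rw [← Set.preimage_univ (f := A.restrict), finiteGibbsMeasure_preimage_restrict,
    ← partitionFunction, div_self (partitionFunction_pos G hs A).ne', ENNReal.ofReal_one]

theorem exists_isGibbsMeasure [Countable V] (G : SimpleGraph V) (hs : ∀ t, M.H t s ≠ ⊤) :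
    ∃ μ : Measure (V → χ), IsGibbsMeasure G M μ := by
  classical
  let _ : TopologicalSpace χ := ⊥
  have _ : DiscreteTopology χ := ⟨rfl⟩
  let P : Finset V → ProbabilityMeasure (V → χ) := fun A =>
    ⟨finiteGibbsMeasure G M s A, isProbabilityMeasure_finiteGibbsMeasure G hs A⟩
  let 𝒰 : Ultrafilter (Finset V) := Ultrafilter.of atTop
  have hlarge : ∀ F : Finset V, ∀ᶠ A in (𝒰 : Filter (Finset V)), F ⊆ A := fun F =>
    Ultrafilter.of_le atTop (eventually_ge_atTop F)
  let μ : ProbabilityMeasure (V → χ) := (𝒰.map P).lim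
  have hlim : Tendsto P 𝒰 (𝓝 μ) := (𝒰.map P).le_nhds_lim
  have hpinned : ∀ (F : Finset V) (σ : V → χ),
      Tendsto (fun A => weightOf G M A (cyl A F σ) / partitionFunction G M A) 𝒰
        (𝓝 ((μ : Measure (V → χ)).real (pinned F σ))) := by
    intro F σ
    refine (NNReal.tendsto_coe.2 (ProbabilityMeasure.tendsto_measure_of_isClopen_of_tendsto hlim
      (isClopen_pinned F σ))).congr' ?_
    filter_upwards [hlarge F] with A hA
    rw [← finiteGibbsMeasure_real_preimage_restrict G M s,
      preimage_restrict_cyl (Finset.coe_subset.2 hA)]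
    rfl
  refine ⟨μ, inferInstance, fun Λ Δ hΛΔ hΛ σ => tendsto_nhds_unique (hpinned Δ σ) ?_⟩
  have hsdiff : {ω : V → χ | ∀ v ∈ Δ, v ∉ Λ → ω v = σ v} = pinned (Δ \ Λ : Finset V) σ := by
    ext ω
    simp [pinned]
  rw [hsdiff]
  refine ((hpinned (Δ \ Λ) σ).const_mul _).congr' ?_
  filter_upwards [hlarge Δ] with A hA
  rw [weightOf_cyl_eq_finCondProb_mul hA hΛΔ hΛ, Finset.coe_sdiff, mul_div_assoc]
  rfl

theorem StrongSpatialMixing.existsUnique_isGibbsMeasure [Countable V]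
    (hSSM : StrongSpatialMixing G M) (hG : ∀ v, (G.neighborSet v).Finite)
    (hs : ∀ t, M.H t s ≠ ⊤) : ∃! μ : Measure (V → χ), IsGibbsMeasure G M μ :=
  existsUnique_of_exists_of_unique (exists_isGibbsMeasure G hs) fun _ _ hμ hν =>
    hμ.unique hSSM hG hs hν

end Existence

section Invariance

variable {V W χ : Type*} {G : SimpleGraph V} {G' : SimpleGraph W}

theorem bonds_map_iso (φ : G ≃g G') (A : Finset V) :
    bonds G' (A.map φ.toEquiv.toEmbedding) = (bonds G A).map φ.toEquiv.toEmbedding.sym2Map := by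
  classical
  rw [bonds, Finset.sym2_map, Finset.filter_map]
  congr 1
  refine Finset.filter_congr ?_
  rintro ⟨_, _⟩ -
  exact φ.map_adj_iff

theorem weight_map_iso (φ : G ≃g G') (M : Model χ) (A : Finset V) (σ : W → χ) :
    weight G' M (A.map φ.toEquiv.toEmbedding) (Finset.restrict _ σ) =
      weight G M A (A.restrict (σ ∘ φ)) := by
  rw [weight, weight, energy_restrict, energy_restrict, bonds_map_iso, Finset.sum_map,
    Finset.sum_map]
  congr 2
  exact Finset.sum_congr rfl fun e _ => congrArg M.pair (Sym2.map_map e)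

variable [Fintype χ]

theorem weightOf_cyl_map_iso (φ : G ≃g G') (M : Model χ) (A : Finset V) (F : Set W) (σ : W → χ) :
    weightOf G' M (A.map φ.toEquiv.toEmbedding) (cyl _ F σ) =
      weightOf G M A (cyl A (φ ⁻¹' F) (σ ∘ φ)) := by
  have hmem : ∀ v : A, φ v ∈ A.map φ.toEquiv.toEmbedding := fun v =>
    Finset.mem_map_of_mem φ.toEquiv.toEmbedding v.2
  let pullback (τ : A.map φ.toEquiv.toEmbedding → χ) (v : A) : χ := τ ⟨φ v, hmem v⟩
  have hcyl : ∀ τ, pullback τ ∈ cyl A (φ ⁻¹' F) (σ ∘ φ) ↔ τ ∈ cyl _ F σ := by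
    refine fun τ => ⟨?_, fun h v => h ⟨φ v, hmem v⟩⟩
    rintro h ⟨w, hw⟩
    obtain ⟨v, hv, rfl⟩ := Finset.mem_map.1 hw
    exact h ⟨v, hv⟩
  have hbij : Set.BijOn pullback (cyl _ F σ) (cyl A (φ ⁻¹' F) (σ ∘ φ)) := by
    refine ⟨fun τ hτ => (hcyl τ).2 hτ, fun τ _ τ' _ h => funext ?_, fun τ hτ => ?_⟩
    · rintro ⟨w, hw⟩
      obtain ⟨v, hv, rfl⟩ := Finset.mem_map.1 hw
      exact congrFun h ⟨v, hv⟩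
    · have hpull : pullback (Finset.restrict _ (Function.extend Subtype.val τ (σ ∘ φ) ∘ φ.symm)) =
          τ := (funext fun v => by simp [pullback]).trans (restrict_extend A τ (σ ∘ φ))
      exact ⟨_, (hcyl _).1 (hpull.symm ▸ hτ), hpull⟩
  rw [← one_mul (weightOf G M A _)]
  refine mass_eq_mul_mass_of_bijOn hbij fun τ _ => ?_
  obtain ⟨ω, rfl⟩ : ∃ ω : W → χ, Finset.restrict _ ω = τ := ⟨_, restrict_extend _ τ σ⟩
  rw [weight_map_iso, one_mul]
  rfl

theorem finCondProb_cyl_map_iso (φ : G ≃g G') (M : Model χ) (A : Finset V) (X F : Set W)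
    (σ : W → χ) :
    finCondProb G' M (A.map φ.toEquiv.toEmbedding) (cyl _ X σ) (cyl _ F σ) =
      finCondProb G M A (cyl A (φ ⁻¹' X) (σ ∘ φ)) (cyl A (φ ⁻¹' F) (σ ∘ φ)) := by
  simp only [finCondProb, cyl_inter_cyl, weightOf_cyl_map_iso, Set.preimage_union]

end Invariance

section ChainRule

theorem sum_insert_filter_lt_sub {ι L E : Type*} [DecidableEq ι] [LinearOrder L] [AddCommGroup E]
    {f : ι → L} (hf : Function.Injective f) (g : Finset ι → E) (S : Finset ι) :
    ∑ i ∈ S, (g (insert i {j ∈ S | f i < f j}) - g {j ∈ S | f i < f j}) = g S - g ∅ := by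
  induction S using Finset.induction_on_min_value f with
  | empty => simp
  | insert a S ha hmin ih =>
    have hlt : ∀ i ∈ S, f a < f i := fun i hi =>
      (hmin i hi).lt_of_ne fun h => ha (hf h ▸ hi)
    have hlater : ∀ i ∈ S, {j ∈ insert a S | f i < f j} = {j ∈ S | f i < f j} := fun i hi => by
      rw [Finset.filter_insert, if_neg (hlt i hi).le.not_gt]
    rw [Finset.sum_insert ha, Finset.filter_insert, if_neg (lt_irrefl _),
      Finset.filter_true_of_mem hlt, Finset.sum_congr rfl fun i hi => by rw [hlater i hi], ih,
      sub_add_sub_cancel]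

theorem sum_log_finCondProb_eq_log_sub_log {V χ ι L : Type*} [Fintype χ] [LinearOrder L]
    {f : ι → L} (hf : Function.Injective f) (G : SimpleGraph V) {M : Model χ} {s : χ}
    (hs : ∀ t, M.H t s ≠ ⊤) (A : Finset V) (X : ι → Set V) (S : Finset ι) :
    ∑ i ∈ S, Real.log (finCondProb G M A (cyl A (X i) fun _ => s)
        (cyl A (⋃ j ∈ {j | j ∈ S ∧ f i < f j}, X j) fun _ => s)) =
      Real.log (weightOf G M A (cyl A (⋃ j ∈ S, X j) fun _ => s)) -
        Real.log (partitionFunction G M A) := by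
  classical
  have hpos : ∀ F : Set V, weightOf G M A (cyl A F fun _ => s) ≠ 0 := fun F =>
    (weightOf_cyl_const_pos G hs A F).ne'
  have huniv : cyl A ∅ (fun _ => s) = Set.univ :=
    Set.eq_univ_of_forall fun _ _ hv => absurd hv (Set.notMem_empty _)
  have htel := sum_insert_filter_lt_sub hf
    (fun T => Real.log (weightOf G M A (cyl A (⋃ j ∈ T, X j) fun _ => s))) S
  simp only [Finset.set_biUnion_insert, Finset.mem_filter, Finset.notMem_empty, Set.iUnion_of_empty,
    Set.iUnion_empty, huniv] at htel
  rw [partitionFunction, ← htel]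
  exact Finset.sum_congr rfl fun i _ => by
    rw [finCondProb, cyl_inter_cyl, Real.log_div (hpos _) (hpos _)]
    rfl

end ChainRule

section Lattice

variable {d : ℕ}

/-- The `2 d` unit vectors of `ℤ ^ d`, indexed by a coordinate and a sign. -/
def unitVector (p : Fin d × Bool) : Fin d → ℤ :=
  Pi.single p.1 (if p.2 then 1 else -1)

theorem unitVector_injective : Function.Injective (unitVector (d := d)) := by
  rintro ⟨i, a⟩ ⟨j, b⟩ h
  have hi := congrFun h i
  by_cases hij : i = j
  · subst hij
    cases a <;> cases b <;> simp [unitVector] at hi ⊢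
  · cases a <;> simp [unitVector, hij] at hi

theorem lattice_adj_add_unitVector (v : Fin d → ℤ) (p : Fin d × Bool) :
    (lattice d).Adj v (v + unitVector p) := by
  obtain ⟨i, b⟩ := p
  change ∑ j, |v j - (v + unitVector (i, b)) j| = 1
  rw [Finset.sum_eq_single i (fun j _ hj => by simp [unitVector, hj]) (by simp)]
  cases b <;> simp [unitVector]

theorem lattice_adj_iff {v u : Fin d → ℤ} :
    (lattice d).Adj v u ↔ ∃ p : Fin d × Bool, u = v + unitVector p := by
  refine ⟨fun h => ?_, fun ⟨p, hp⟩ => hp ▸ lattice_adj_add_unitVector v p⟩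
  replace h : ∑ i, |v i - u i| = 1 := h
  obtain ⟨i, -, hi⟩ : ∃ i ∈ Finset.univ, |v i - u i| ≠ 0 :=
    Finset.exists_ne_zero_of_sum_ne_zero (h ▸ one_ne_zero)
  have hi1 : 1 ≤ |v i - u i| := Int.one_le_abs (abs_ne_zero.1 hi)
  have hrest : 0 ≤ ∑ j ∈ Finset.univ.erase i, |v j - u j| :=
    Finset.sum_nonneg fun j _ => abs_nonneg _
  rw [← Finset.add_sum_erase _ _ (Finset.mem_univ i)] at h
  have hsum : ∑ j ∈ Finset.univ.erase i, |v j - u j| = 0 := by linarith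
  have hzero : ∀ j ≠ i, |v j - u j| = 0 := fun j hj =>
    (Finset.sum_eq_zero_iff_of_nonneg fun j _ => abs_nonneg _).1 hsum j
      (Finset.mem_erase.2 ⟨hj, Finset.mem_univ j⟩)
  refine ⟨(i, decide (v i - u i = -1)), funext fun j => ?_⟩
  by_cases hj : j = i
  · subst hj
    rcases (abs_eq one_pos.le).1 (by linarith : |v j - u j| = 1) with h1 | h1 <;>
      simp [unitVector, h1] <;> linarith
  · simpa [unitVector, hj, sub_eq_zero, eq_comm] using hzero j hj

/-- The edge between `v` and its neighbour `v + unitVector p`. -/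
def edgeAt (v : Fin d → ℤ) : Fin d × Bool ↪ LatticeEdge d where
  toFun p := ⟨s(v, v + unitVector p), lattice_adj_add_unitVector v p⟩
  inj' _ _ h := unitVector_injective (add_left_cancel (Sym2.congr_right.1 (congrArg Subtype.val h)))

/-- The `2 d` edges at the node `v`. -/
def edgesAt (v : Fin d → ℤ) : Finset (LatticeEdge d) :=
  Finset.univ.map (edgeAt v)

theorem mem_edgesAt {v : Fin d → ℤ} {e : LatticeEdge d} :
    e ∈ edgesAt v ↔ v ∈ (e : Sym2 (Fin d → ℤ)) := by
  rw [edgesAt, Finset.mem_map]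
  constructor
  · rintro ⟨p, -, rfl⟩
    exact Sym2.mem_mk_left _ _
  · obtain ⟨e, he⟩ := e
    rintro ⟨u, rfl⟩
    obtain ⟨p, rfl⟩ := lattice_adj_iff.1 (show (lattice d).Adj v u from he)
    exact ⟨p, Finset.mem_univ p, rfl⟩

theorem card_edgesAt (v : Fin d → ℤ) : (edgesAt v).card = 2 * d := by
  simp [edgesAt, mul_comm]

theorem edgeGraph_neighborSet_finite (e : LatticeEdge d) :
    ((edgeGraph d).neighborSet e).Finite := by
  classical
  refine (((e : Sym2 (Fin d → ℤ)).toFinset.biUnion edgesAt).finite_toSet).subset fun e' he' => ?_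
  obtain ⟨-, v, hv, hv'⟩ := SimpleGraph.lineGraph_adj_iff_exists.1 he'
  exact Finset.mem_biUnion.2 ⟨v, Sym2.mem_toFinset.2 hv, mem_edgesAt.2 hv'⟩

theorem mem_edgesIn {Λ : Finset (Fin d → ℤ)} {e : LatticeEdge d} :
    e ∈ edgesIn d Λ ↔ ∀ v ∈ (e : Sym2 (Fin d → ℤ)), v ∈ Λ := by
  simp only [edgesIn, Finset.mem_subtype, Finset.mem_sym2_iff]

theorem edgesAt_subset_edgesIn {Λ : Finset (Fin d → ℤ)} {v : Fin d → ℤ} (hv : v ∈ Λ)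
    (h : ∀ p, v + unitVector p ∈ Λ) : edgesAt v ⊆ edgesIn d Λ := by
  intro e he
  obtain ⟨p, -, rfl⟩ := Finset.mem_map.1 he
  refine mem_edgesIn.2 fun u hu => ?_
  rcases Sym2.mem_iff.1 hu with rfl | rfl
  exacts [hv, h p]

/-- The translation of the lattice by `v`. -/
def shift (v : Fin d → ℤ) : lattice d ≃g lattice d where
  toEquiv := Equiv.addRight v
  map_rel_iff' := by simp [lattice]

theorem mem_map_shift {v u : Fin d → ℤ} {Λ : Finset (Fin d → ℤ)} :
    u + v ∈ Λ.map (shift v).toEquiv.toEmbedding ↔ u ∈ Λ :=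
  Finset.mem_map' (shift v).toEquiv.toEmbedding

theorem mem_shift_lineGraph_iff {v u : Fin d → ℤ} {e : LatticeEdge d} :
    u ∈ ((shift v).lineGraph e : Sym2 (Fin d → ℤ)) ↔ ∃ w ∈ (e : Sym2 (Fin d → ℤ)), w + v = u :=
  Sym2.mem_map

theorem edgesIn_map_shift (v : Fin d → ℤ) (Λ : Finset (Fin d → ℤ)) :
    edgesIn d (Λ.map (shift v).toEquiv.toEmbedding) =
      (edgesIn d Λ).map (shift v).lineGraph.toEquiv.toEmbedding := by
  ext e
  obtain ⟨e, rfl⟩ := (shift v).lineGraph.surjective e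
  have hmap : (shift v).lineGraph e ∈ (edgesIn d Λ).map (shift v).lineGraph.toEquiv.toEmbedding ↔
      e ∈ edgesIn d Λ := Finset.mem_map' _
  simp only [hmap, mem_edgesIn, mem_shift_lineGraph_iff, forall_exists_index, and_imp,
    forall_apply_eq_imp_iff₂, mem_map_shift]

end Lattice

section VanHove

variable {d : ℕ}

/-- The filter of the finite non-empty sets of nodes whose proportion of boundary nodes tends to
zero: the limits along it are the common limits along all sequences as in `IsPressure`. -/
noncomputable def vanHove (d : ℕ) : Filter (Finset (Fin d → ℤ)) :=
  comap (fun Λ => ((boundary (lattice d) (Λ : Set (Fin d → ℤ))).ncard : ℝ) / Λ.card) (𝓝 0) ⊓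
    𝓟 {Λ | Λ.Nonempty}

theorem tendsto_boundary_div_card :
    Tendsto (fun Λ : Finset (Fin d → ℤ) =>
        ((boundary (lattice d) (Λ : Set (Fin d → ℤ))).ncard : ℝ) / Λ.card) (vanHove d) (𝓝 0) :=
  tendsto_comap.mono_left inf_le_left

theorem eventually_nonempty_vanHove : ∀ᶠ Λ in vanHove d, Λ.Nonempty :=
  mem_inf_of_right (mem_principal_self _)

theorem tendsto_vanHove {ι : Type*} {l : Filter ι} {Λ : ι → Finset (Fin d → ℤ)}
    (hne : ∀ i, (Λ i).Nonempty)
    (hΛ : Tendsto (fun i => ((boundary (lattice d) (Λ i : Set (Fin d → ℤ))).ncard : ℝ) /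
      (Λ i).card) l (𝓝 0)) : Tendsto Λ l (vanHove d) :=
  tendsto_inf.2 ⟨tendsto_comap_iff.2 hΛ, tendsto_principal.2 (.of_forall hne)⟩

theorem isPressure_of_tendsto {χ : Type*} [Fintype χ] {M : Model χ} {P : ℝ}
    (h : Tendsto (fun Λ : Finset (Fin d → ℤ) =>
      Real.log (partitionFunction (edgeGraph d) M (edgesIn d Λ)) / Λ.card) (vanHove d) (𝓝 P)) :
    IsPressure d M P :=
  fun _ hne hΛ => h.comp (tendsto_vanHove hne hΛ)

theorem ncard_boundary_box_le (d n : ℕ) :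
    ((boundary (lattice d) (Fintype.piFinset fun _ : Fin d => Finset.Ico (0 : ℤ) (n + 2) :
      Set (Fin d → ℤ))).ncard : ℝ) ≤ (n + 2) ^ d - n ^ d := by
  set box := Fintype.piFinset fun _ : Fin d => Finset.Ico (0 : ℤ) (n + 2)
  let inner := Fintype.piFinset fun _ : Fin d => Finset.Ico (1 : ℤ) (n + 1)
  have hinner : inner ⊆ box :=
    Fintype.piFinset_subset _ _ fun _ => Finset.Ico_subset_Ico (by simp) (by simp)
  have hboundary : boundary (lattice d) (box : Set (Fin d → ℤ)) ⊆ (box \ inner : Finset _) := by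
    rintro v ⟨hv, u, huv, hu⟩
    refine Finset.mem_sdiff.2 ⟨hv, fun hv' => hu (Fintype.mem_piFinset.2 fun i => ?_)⟩
    obtain ⟨⟨j, b⟩, rfl⟩ := lattice_adj_iff.1 huv
    have hi := Finset.mem_Ico.1 (Fintype.mem_piFinset.1 hv' i)
    rw [Finset.mem_Ico]
    by_cases hij : i = j
    · subst hij
      cases b <;> simp [unitVector] <;> omega
    · simp [unitVector, hij]
      omega
  have htoNat : ((n : ℤ) + 2).toNat = n + 2 := by omega
  calc ((boundary (lattice d) (box : Set (Fin d → ℤ))).ncard : ℝ)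
      ≤ (box \ inner).card := by
        exact_mod_cast (Set.ncard_le_ncard hboundary).trans_eq (Set.ncard_coe_finset _)
    _ = (n + 2) ^ d - n ^ d := by
        rw [Finset.cast_card_sdiff hinner]
        simp [box, inner, htoNat]

instance vanHove_neBot (d : ℕ) : (vanHove d).NeBot := by
  let box (n : ℕ) := Fintype.piFinset fun _ : Fin d => Finset.Ico (0 : ℤ) (n + 2)
  have hcard : ∀ n, ((box n).card : ℝ) = (n + 2) ^ d := fun n => by
    have htoNat : ((n : ℤ) + 2).toNat = n + 2 := by omega
    simp [box, htoNat]
  have hne : ∀ n, (box n).Nonempty := fun n =>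
    Fintype.piFinset_nonempty.2 fun _ => Finset.nonempty_Ico.2 (by positivity)
  have hlim : Tendsto (fun n : ℕ => 1 - ((n : ℝ) / (n + 2)) ^ d) atTop (𝓝 0) := by
    simpa using ((tendsto_natCast_div_add_atTop (2 : ℝ)).pow d).const_sub 1
  refine (tendsto_vanHove hne (squeeze_zero (fun n => by positivity) (fun n => ?_) hlim)).neBot
  have hpos : (0 : ℝ) < (n + 2) ^ d := by positivity
  rw [hcard, div_le_iff₀ hpos, sub_mul, div_pow, div_mul_cancel₀ _ hpos.ne', one_mul]
  exact ncard_boundary_box_le d n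

open Classical in
/-- The nodes of `Λ` which the translation by `x` moves out of `Λ`. -/
noncomputable def escaping (x : Fin d → ℤ) (Λ : Finset (Fin d → ℤ)) : Finset (Fin d → ℤ) :=
  {v ∈ Λ | v + x ∉ Λ}

theorem mem_escaping {x v : Fin d → ℤ} {Λ : Finset (Fin d → ℤ)} :
    v ∈ escaping x Λ ↔ v ∈ Λ ∧ v + x ∉ Λ := by simp [escaping]

theorem card_escaping_unitVector_le (p : Fin d × Bool) (Λ : Finset (Fin d → ℤ)) :
    (escaping (unitVector p) Λ).card ≤ (boundary (lattice d) (Λ : Set (Fin d → ℤ))).ncard := by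
  rw [← Set.ncard_coe_finset]
  refine Set.ncard_le_ncard (fun v hv => ?_) (Λ.finite_toSet.subset fun v hv => hv.1)
  obtain ⟨hvΛ, hv⟩ := mem_escaping.1 hv
  exact ⟨hvΛ, _, lattice_adj_add_unitVector v p, hv⟩

theorem card_escaping_add_le (x y : Fin d → ℤ) (Λ : Finset (Fin d → ℤ)) :
    (escaping (x + y) Λ).card ≤ (escaping x Λ).card + (escaping y Λ).card := by
  classical
  have hsub : escaping (x + y) Λ ⊆
      escaping x Λ ∪ (escaping y Λ).preimage (· + x) (add_left_injective x).injOn := by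
    intro v hv
    simp only [Finset.mem_union, Finset.mem_preimage, mem_escaping, add_assoc] at hv ⊢
    tauto
  refine (Finset.card_le_card hsub).trans ((Finset.card_union_le _ _).trans ?_)
  exact Nat.add_le_add_left (Finset.card_le_card_of_injOn (· + x)
    (fun _ hv => Finset.mem_preimage (f := (· + x)) |>.1 hv) (add_left_injective x).injOn) _

theorem tendsto_card_escaping_div_card (x : Fin d → ℤ) :
    Tendsto (fun Λ : Finset (Fin d → ℤ) => ((escaping x Λ).card : ℝ) / Λ.card) (vanHove d)
      (𝓝 0) := by
  let good (x : Fin d → ℤ) : Prop :=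
    Tendsto (fun Λ : Finset (Fin d → ℤ) => ((escaping x Λ).card : ℝ) / Λ.card) (vanHove d) (𝓝 0)
  have hzero : good 0 := by
    have hempty : ∀ Λ : Finset (Fin d → ℤ), escaping 0 Λ = ∅ := fun Λ =>
      Finset.eq_empty_of_forall_notMem fun v => by simp [mem_escaping]
    simp [good, hempty]
  have hadd : ∀ x y, good x → good y → good (x + y) := fun x y hx hy => by
    refine squeeze_zero (fun Λ => by positivity) (fun Λ => ?_) (by simpa using Tendsto.add hx hy)
    rw [← add_div]
    gcongr
    exact_mod_cast card_escaping_add_le x y Λ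
  have hunit : ∀ p, good (unitVector p) := fun p =>
    squeeze_zero (fun Λ => by positivity) (fun Λ => div_le_div_of_nonneg_right
      (Nat.cast_le.2 (card_escaping_unitVector_le p Λ)) Λ.card.cast_nonneg)
      tendsto_boundary_div_card
  have hsingle : ∀ i n, good (Pi.single i n) := fun i n => by
    induction n with
    | zero => simpa using hzero
    | succ n ih => simpa [unitVector, Pi.single_add] using hadd _ _ ih (hunit (i, true))
    | pred n ih =>
      simpa [unitVector, sub_eq_add_neg, Pi.single_add] using hadd _ _ ih (hunit (i, false))
  have hx : good (∑ i, Pi.single i (x i)) :=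
    Finset.sum_induction _ good hadd hzero fun i _ => hsingle i (x i)
  rwa [Finset.univ_sum_single] at hx

theorem tendsto_card_biUnion_escaping_div_card [DecidableEq (Fin d → ℤ)]
    (D : Finset (Fin d → ℤ)) :
    Tendsto (fun Λ : Finset (Fin d → ℤ) => ((D.biUnion (escaping · Λ)).card : ℝ) / Λ.card)
      (vanHove d) (𝓝 0) := by
  refine squeeze_zero (fun Λ => by positivity) (fun Λ => ?_)
    (by simpa using tendsto_finsetSum D fun x _ => tendsto_card_escaping_div_card x)
  rw [← Finset.sum_div]
  gcongr
  exact_mod_cast Finset.card_biUnion_le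

theorem tendsto_sum_div_card {f : Finset (Fin d → ℤ) → (Fin d → ℤ) → ℝ} {a K : ℝ}
    (hK : ∀ Λ, ∀ v ∈ Λ, |f Λ v - a| ≤ K)
    (hloc : ∀ ε > 0, ∃ D : Finset (Fin d → ℤ), ∀ Λ, ∀ v ∈ Λ, (∀ x ∈ D, v + x ∈ Λ) →
      |f Λ v - a| ≤ ε) :
    Tendsto (fun Λ : Finset (Fin d → ℤ) => (∑ v ∈ Λ, f Λ v) / Λ.card) (vanHove d) (𝓝 a) := by
  classical
  refine Metric.tendsto_nhds.2 fun ε hε => ?_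
  obtain ⟨D, hD⟩ := hloc (ε / 2) (half_pos hε)
  let bad (Λ : Finset (Fin d → ℤ)) := D.biUnion (escaping · Λ)
  have hsmall : Tendsto (fun Λ : Finset (Fin d → ℤ) => ε / 2 + K * ((bad Λ).card / Λ.card))
      (vanHove d) (𝓝 (ε / 2)) := by
    simpa using ((tendsto_card_biUnion_escaping_div_card D).const_mul K).const_add (ε / 2)
  filter_upwards [hsmall.eventually (gt_mem_nhds (half_lt_self hε)), eventually_nonempty_vanHove]
    with Λ hΛ hne
  have hcard : (0 : ℝ) < Λ.card := by exact_mod_cast hne.card_pos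
  have hbad : bad Λ ⊆ Λ := Finset.biUnion_subset.2 fun x _ v hv => (mem_escaping.1 hv).1
  have hterm : ∀ v ∈ Λ, |f Λ v - a| ≤ ε / 2 + if v ∈ bad Λ then K else 0 := by
    intro v hv
    split_ifs with h
    · exact (hK Λ v hv).trans (le_add_of_nonneg_left (half_pos hε).le)
    · refine (hD Λ v hv fun x hx => ?_).trans_eq (add_zero _).symm
      by_contra hvx
      exact h (Finset.mem_biUnion.2 ⟨x, hx, mem_escaping.2 ⟨hv, hvx⟩⟩)
  calc |(∑ v ∈ Λ, f Λ v) / Λ.card - a| = |∑ v ∈ Λ, (f Λ v - a)| / Λ.card := by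
        rw [Finset.sum_sub_distrib, Finset.sum_const, nsmul_eq_mul, ← abs_of_pos hcard,
          ← abs_div, abs_of_pos hcard, sub_div, mul_div_cancel_left₀ _ hcard.ne']
    _ ≤ (∑ v ∈ Λ, (ε / 2 + if v ∈ bad Λ then K else 0)) / Λ.card := by
        gcongr
        exact (Finset.abs_sum_le_sum_abs _ _).trans (Finset.sum_le_sum hterm)
    _ = ε / 2 + K * ((bad Λ).card / Λ.card) := by
        rw [Finset.sum_add_distrib, Finset.sum_const, ← Finset.sum_filter,
          Finset.filter_mem_eq_inter, Finset.inter_eq_right.2 hbad, Finset.sum_const]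
        simp only [nsmul_eq_mul]
        field_simp
    _ < ε := hΛ

end VanHove

theorem log_weight_const {V χ : Type*} (G : SimpleGraph V) {M : Model χ} {s : χ}
    (hs : M.H s s ≠ ⊤) (A : Finset V) :
    Real.log (weight G M A fun _ => s) =
      -((bonds G A).card * (M.H s s).untop hs + A.card * M.h s) := by
  have hpair : ∀ e : Sym2 V, M.pair (e.map fun _ => s) = ((M.H s s).untop hs : ℝ) := by
    rintro ⟨_, _⟩
    exact (WithTop.coe_untop _ hs).symm
  have henergy : energy G M A (A.restrict fun _ => s) =
      ((bonds G A).card * (M.H s s).untop hs + A.card * M.h s : ℝ) := by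
    rw [energy_restrict, Finset.sum_congr rfl fun e _ => hpair e, Finset.sum_const,
      Finset.sum_const, ← WithTop.coe_nsmul, ← WithTop.coe_nsmul, ← WithTop.coe_add, nsmul_eq_mul,
      nsmul_eq_mul]
  change Real.log (weight G M A (A.restrict fun _ => s)) = _
  rw [weight, henergy, expNeg_coe, Real.log_exp]

section Counting

theorem mk_mem_image_offDiag {α : Type*} [DecidableEq α] {S : Finset α} {a b : α} :
    s(a, b) ∈ S.offDiag.image Sym2.mk.uncurry ↔ a ∈ S ∧ b ∈ S ∧ a ≠ b := by
  simp only [Finset.mem_image, Finset.mem_offDiag, Prod.exists, Function.uncurry_apply_pair]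
  refine ⟨?_, fun h => ⟨a, b, h, rfl⟩⟩
  rintro ⟨x, y, ⟨hx, hy, hxy⟩, h⟩
  rcases Sym2.eq_iff.1 h with ⟨rfl, rfl⟩ | ⟨rfl, rfl⟩
  exacts [⟨hx, hy, hxy⟩, ⟨hy, hx, hxy.symm⟩]

variable {d : ℕ}

theorem sum_card_edgesAt_inter_edgesIn (Λ : Finset (Fin d → ℤ)) :
    ∑ v ∈ Λ, (edgesAt v ∩ edgesIn d Λ).card = 2 * (edgesIn d Λ).card := by
  let incident (v : Fin d → ℤ) (e : LatticeEdge d) : Prop := v ∈ (e : Sym2 (Fin d → ℤ))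
  classical
  have hedges : ∀ v, edgesAt v ∩ edgesIn d Λ = (edgesIn d Λ).bipartiteAbove incident v := by
    intro v
    ext e
    simp only [Finset.mem_inter, mem_edgesAt, Finset.mem_bipartiteAbove, incident, and_comm]
  have hnodes : ∀ e ∈ edgesIn d Λ, (Λ.bipartiteBelow incident e).card = 2 := fun e he => by
    rw [← Sym2.card_toFinset_of_not_isDiag _ (SimpleGraph.not_isDiag_of_mem_edgeSet _ e.2)]
    congr 1
    ext v
    simpa [incident] using mem_edgesIn.1 he v
  simp only [hedges]
  rw [Finset.sum_card_bipartiteAbove_eq_sum_card_bipartiteBelow, Finset.sum_congr rfl hnodes,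
    Finset.sum_const, smul_eq_mul, mul_comm]

theorem card_bonds_edgesIn (Λ : Finset (Fin d → ℤ)) :
    (bonds (edgeGraph d) (edgesIn d Λ)).card =
      ∑ v ∈ Λ, (edgesAt v ∩ edgesIn d Λ).card.choose 2 := by
  have hmem : ∀ {e e' : LatticeEdge d} {v : Fin d → ℤ},
      s(e, e') ∈ (edgesAt v ∩ edgesIn d Λ).offDiag.image Sym2.mk.uncurry ↔
        ((e ∈ edgesIn d Λ ∧ e' ∈ edgesIn d Λ) ∧ e ≠ e') ∧ v ∈ e.1 ∧ v ∈ e'.1 := by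
    simp only [mk_mem_image_offDiag, Finset.mem_inter, mem_edgesAt]
    tauto
  have hbonds : bonds (edgeGraph d) (edgesIn d Λ) =
      Λ.biUnion fun v => (edgesAt v ∩ edgesIn d Λ).offDiag.image Sym2.mk.uncurry := by
    ext ⟨e, e'⟩
    rw [mk_mem_bonds, SimpleGraph.lineGraph_adj_iff_exists, Finset.mem_biUnion]
    simp only [hmem]
    constructor
    · rintro ⟨he, hne, v, hv⟩
      exact ⟨v, mem_edgesIn.1 he.1 v hv.1, ⟨he, hne⟩, hv⟩
    · rintro ⟨v, -, ⟨he, hne⟩, hv⟩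
      exact ⟨he, hne, v, hv⟩
  rw [hbonds, Finset.card_biUnion]
  · simp only [Sym2.card_image_offDiag]
  · -- Two distinct edges have at most one common end point.
    refine fun v _ w _ hvw => Finset.disjoint_left.2 ?_
    rintro ⟨e, e'⟩ hv hw
    obtain ⟨⟨-, hne⟩, hve, hve'⟩ := hmem.1 hv
    obtain ⟨-, hwe, hwe'⟩ := hmem.1 hw
    exact hne (Subtype.ext (((Sym2.mem_and_mem_iff hvw).1 ⟨hve, hwe⟩).trans
      ((Sym2.mem_and_mem_iff hvw).1 ⟨hve', hwe'⟩).symm))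

theorem tendsto_sum_card_edgesAt_div_card (g : ℕ → ℝ) :
    Tendsto (fun Λ : Finset (Fin d → ℤ) =>
      (∑ v ∈ Λ, g (edgesAt v ∩ edgesIn d Λ).card) / Λ.card) (vanHove d) (𝓝 (g (2 * d))) := by
  refine tendsto_sum_div_card (K := ∑ k ∈ Finset.range (2 * d + 1), |g k - g (2 * d)|)
    (fun Λ v _ => ?_) fun ε hε => ⟨Finset.univ.image unitVector, fun Λ v hv hD => ?_⟩
  · have hcard := card_edgesAt v ▸
      Finset.card_le_card (Finset.inter_subset_left (s₁ := edgesAt v) (s₂ := edgesIn d Λ))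
    exact Finset.single_le_sum (f := fun k => |g k - g (2 * d)|) (fun _ _ => abs_nonneg _)
      (Finset.mem_range_succ_iff.2 hcard)
  · rw [Finset.inter_eq_left.2 (edgesAt_subset_edgesIn hv fun p => hD _ (by simp)), card_edgesAt,
      sub_self, abs_zero]
    exact hε.le

theorem tendsto_log_weight_const_div_card {χ : Type*} {M : Model χ} {s : χ} (hs : M.H s s ≠ ⊤) :
    Tendsto (fun Λ : Finset (Fin d → ℤ) =>
        Real.log (weight (edgeGraph d) M (edgesIn d Λ) fun _ => s) / Λ.card)
      (vanHove d) (𝓝 (-(d * (2 * d - 1) * (M.H s s).untop hs) - d * M.h s)) := by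
  have hbonds := tendsto_sum_card_edgesAt_div_card (d := d) fun k => (k.choose 2 : ℝ)
  have hedges := tendsto_sum_card_edgesAt_div_card (d := d) fun k => (k : ℝ)
  simp only [← Nat.cast_sum, ← card_bonds_edgesIn] at hbonds
  simp only [← Nat.cast_sum, sum_card_edgesAt_inter_edgesIn] at hedges
  convert ((hbonds.mul_const ((M.H s s).untop hs)).add
    (hedges.mul_const (M.h s / 2))).neg using 2 with Λ
  · rw [log_weight_const _ hs]
    push_cast
    ring
  · rw [Nat.cast_choose_two]
    push_cast
    ring

end Counting

section Revealing

variable {d : ℕ} {U : AddSubgroup (Fin d → ℤ)}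

theorem lexLT_iff_toColex_lt {v u : Fin d → ℤ} : LexLT v u ↔ toColex v < toColex u :=
  ⟨fun ⟨k, h, h'⟩ => ⟨k, h', h⟩, fun ⟨k, h', h⟩ => ⟨k, h, h'⟩⟩

theorem lexLT_add_right_iff {u v w : Fin d → ℤ} : LexLT (u + w) (v + w) ↔ LexLT u v := by
  simp only [LexLT, Pi.add_apply, add_lt_add_iff_right, add_left_inj]

/-- The edges at the nodes in the sublattice `U` which are later than `v`. For `v = 0` these are
`laterEdges` and `laterEvenEdges`, if `U` consists of all nodes and of the even ones. -/
def laterEdgesFrom (U : AddSubgroup (Fin d → ℤ)) (v : Fin d → ℤ) : Set (LatticeEdge d) :=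
  {e | ∃ u ∈ (e : Sym2 (Fin d → ℤ)), LexLT v u ∧ u ∈ U}

theorem preimage_shift_edgesAt (v w : Fin d → ℤ) :
    (shift v).lineGraph ⁻¹' (edgesAt (w + v) : Set (LatticeEdge d)) = edgesAt w := by
  ext e
  simp [mem_edgesAt, mem_shift_lineGraph_iff]

theorem preimage_shift_laterEdgesFrom {v : Fin d → ℤ} (hv : v ∈ U) (w : Fin d → ℤ) :
    (shift v).lineGraph ⁻¹' laterEdgesFrom U (w + v) = laterEdgesFrom U w := by
  ext e
  simp only [laterEdgesFrom, Set.mem_preimage, Set.mem_ofPred_eq, mem_shift_lineGraph_iff,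
    exists_exists_and_eq_and, lexLT_add_right_iff, U.add_mem_cancel_right hv]

variable {χ : Type*} [Fintype χ] {M : Model χ} {s : χ}

/-- In the edge model on `E(Λ)`, the conditional probability that all the edges at `v` have spin
`s`, given that those at the later nodes in the sublattice `U` have spin `s`. -/
noncomputable def nodeProb (M : Model χ) (s : χ) (U : AddSubgroup (Fin d → ℤ))
    (Λ : Finset (Fin d → ℤ)) (v : Fin d → ℤ) : ℝ :=
  finCondProb (edgeGraph d) M (edgesIn d Λ) (cyl _ (edgesAt v) fun _ => s)
    (cyl _ (laterEdgesFrom U v) fun _ => s)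

theorem nodeProb_map_shift {v : Fin d → ℤ} (hv : v ∈ U) (M : Model χ) (s : χ)
    (Λ : Finset (Fin d → ℤ)) (w : Fin d → ℤ) :
    nodeProb M s U (Λ.map (shift v).toEquiv.toEmbedding) (w + v) = nodeProb M s U Λ w := by
  rw [nodeProb, edgesIn_map_shift, finCondProb_cyl_map_iso, preimage_shift_edgesAt,
    preimage_shift_laterEdgesFrom hv]
  rfl

theorem nodeProb_eq_nodeProb_zero {v : Fin d → ℤ} (hv : v ∈ U) (M : Model χ) (s : χ)
    (Λ : Finset (Fin d → ℤ)) :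
    nodeProb M s U Λ v = nodeProb M s U (Λ.map (shift (-v)).toEquiv.toEmbedding) 0 := by
  rw [← nodeProb_map_shift (U.neg_mem hv) M s Λ v, add_neg_cancel]

open Classical in
theorem log_partitionFunction_edgesIn (hs : ∀ t, M.H t s ≠ ⊤)
    (hU : ∀ e : LatticeEdge d, ∃ u ∈ (e : Sym2 (Fin d → ℤ)), u ∈ U) (Λ : Finset (Fin d → ℤ)) :
    Real.log (partitionFunction (edgeGraph d) M (edgesIn d Λ)) =
      Real.log (weight (edgeGraph d) M (edgesIn d Λ) fun _ => s) -
        ∑ v ∈ Λ with v ∈ U, Real.log (nodeProb M s U Λ v) := by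
  have hlater : ∀ v, cyl (edgesIn d Λ) (⋃ u ∈ {u | u ∈ Λ.filter (· ∈ U) ∧ toColex v < toColex u},
      (edgesAt u : Set (LatticeEdge d))) (fun _ => s) = cyl _ (laterEdgesFrom U v) fun _ => s :=
    fun v => cyl_congr (fun e he => by
      have := mem_edgesIn.1 he
      simp only [Set.mem_iUnion, Set.mem_ofPred_eq, Finset.mem_filter, Finset.mem_coe, mem_edgesAt,
        exists_prop, laterEdgesFrom, lexLT_iff_toColex_lt]
      grind) _
  have hall : cyl (edgesIn d Λ) (⋃ u ∈ Λ.filter (· ∈ U), (edgesAt u : Set (LatticeEdge d)))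
      (fun _ => s) = {fun _ => s} := by
    refine Set.eq_singleton_iff_unique_mem.2 ⟨fun _ _ => rfl, fun τ hτ => funext fun e => hτ e ?_⟩
    obtain ⟨u, hu, huU⟩ := hU e
    exact Set.mem_biUnion (Finset.mem_filter.2 ⟨mem_edgesIn.1 e.2 u hu, huU⟩) (mem_edgesAt.2 hu)
  have hchain := sum_log_finCondProb_eq_log_sub_log (toColex (α := Fin d → ℤ)).injective
    (edgeGraph d) hs (edgesIn d Λ) (fun v => (edgesAt v : Set (LatticeEdge d))) (Λ.filter (· ∈ U))
  rw [hall, weightOf_singleton] at hchain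
  have hsum : ∑ v ∈ Λ with v ∈ U, Real.log (nodeProb M s U Λ v) =
      Real.log (weight (edgeGraph d) M (edgesIn d Λ) fun _ => s) -
        Real.log (partitionFunction (edgeGraph d) M (edgesIn d Λ)) :=
    (Finset.sum_congr rfl fun v _ => by rw [nodeProb, ← hlater v]; rfl).trans hchain
  rw [hsum, sub_sub_cancel]

theorem exists_abs_log_nodeProb_le (hs : ∀ t, M.H t s ≠ ⊤) (U : AddSubgroup (Fin d → ℤ)) :
    ∃ K, ∀ Λ : Finset (Fin d → ℤ), ∀ v ∈ U, |Real.log (nodeProb M s U Λ v)| ≤ K := by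
  obtain ⟨c, hc, hle⟩ := exists_pos_le_condMass edgeGraph_neighborSet_finite hs (edgesAt (d := d) 0)
  refine ⟨-Real.log c, fun Λ v hv => ?_⟩
  rw [nodeProb_eq_nodeProb_zero hv]
  set Λ' := Λ.map (shift (-v)).toEquiv.toEmbedding
  have hlow : c ≤ nodeProb M s U Λ' 0 :=
    hle _ _ (isLocallyGibbs_weight _ M _ _) _ (weightOf_cyl_const_pos _ hs _ _)
  rw [abs_of_nonpos (Real.log_nonpos (hc.le.trans hlow) (finCondProb_le_one _ M _ _ _))]
  exact neg_le_neg (Real.log_le_log hc hlow)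

theorem HasBulkCondProb.exists_abs_nodeProb_sub_le {p : ℝ} (hs : ∀ t, M.H t s ≠ ⊤)
    (hp : HasBulkCondProb (edgeGraph d) M (edgesAt 0) (fun _ => s) (laterEdgesFrom U 0) s p)
    {ε : ℝ} (hε : 0 < ε) :
    ∃ D : Finset (Fin d → ℤ), ∀ Λ : Finset (Fin d → ℤ), ∀ v ∈ U, (∀ x ∈ D, v + x ∈ Λ) →
      |nodeProb M s U Λ v - p| ≤ ε := by
  classical
  obtain ⟨B, hB⟩ := hp ε hε
  refine ⟨B.biUnion fun e => (e : Sym2 (Fin d → ℤ)).toFinset, fun Λ v hv hD => ?_⟩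
  rw [nodeProb_eq_nodeProb_zero hv]
  refine hB _ (fun e he => mem_edgesIn.2 fun u hu => ?_) _ (isLocallyGibbs_weight _ M _ _) _
    (fun _ _ => Iff.rfl) (weightOf_cyl_const_pos _ hs _ _)
  have hvu := hD u (Finset.mem_biUnion.2 ⟨e, he, Sym2.mem_toFinset.2 hu⟩)
  rwa [← add_neg_cancel_comm v u, mem_map_shift]

open Classical in
theorem HasBulkCondProb.tendsto_sum_log_nodeProb_sub_div_card {p : ℝ} (hs : ∀ t, M.H t s ≠ ⊤)
    (hp : HasBulkCondProb (edgeGraph d) M (edgesAt 0) (fun _ => s) (laterEdgesFrom U 0) s p) :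
    Tendsto (fun Λ : Finset (Fin d → ℤ) =>
        (∑ v ∈ Λ with v ∈ U, (Real.log (nodeProb M s U Λ v) - Real.log p)) / Λ.card)
      (vanHove d) (𝓝 0) := by
  obtain ⟨K, hK⟩ := exists_abs_log_nodeProb_le hs U
  simp only [Finset.sum_filter]
  refine tendsto_sum_div_card (K := |K| + |Real.log p|) (fun Λ v _ => ?_) fun ε hε => ?_
  · rw [sub_zero]
    split_ifs with hv
    · exact (abs_sub _ _).trans (add_le_add_left ((hK Λ v hv).trans (le_abs_self K)) _)
    · simp only [abs_zero]
      positivity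
  · obtain ⟨δ, hδ, hlog⟩ := Metric.continuousAt_iff.1
      (Real.continuousAt_log (hp.pos edgeGraph_neighborSet_finite hs).ne') ε hε
    obtain ⟨D, hD⟩ := hp.exists_abs_nodeProb_sub_le hs (half_pos hδ)
    refine ⟨D, fun Λ v _ hvD => ?_⟩
    rw [sub_zero]
    split_ifs with hv
    · exact (hlog ((hD Λ v hv hvD).trans_lt (half_lt_self hδ))).le
    · simpa using hε.le

open Classical in
theorem HasBulkCondProb.tendsto_log_partitionFunction_div_card {κ p : ℝ}
    (hs : ∀ t, M.H t s ≠ ⊤)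
    (hp : HasBulkCondProb (edgeGraph d) M (edgesAt 0) (fun _ => s) (laterEdgesFrom U 0) s p)
    (hU : ∀ e : LatticeEdge d, ∃ u ∈ (e : Sym2 (Fin d → ℤ)), u ∈ U)
    (hκ : Tendsto (fun Λ : Finset (Fin d → ℤ) => ((Λ.filter (· ∈ U)).card : ℝ) / Λ.card)
      (vanHove d) (𝓝 κ)) :
    Tendsto (fun Λ : Finset (Fin d → ℤ) =>
        Real.log (partitionFunction (edgeGraph d) M (edgesIn d Λ)) / Λ.card) (vanHove d)
      (𝓝 (-κ * Real.log p - d * (2 * d - 1) * (M.H s s).untop (hs s) - d * M.h s)) := by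
  convert (tendsto_log_weight_const_div_card (hs s)).sub
    ((hp.tendsto_sum_log_nodeProb_sub_div_card hs).add (hκ.mul_const (Real.log p))) using 2 with Λ
  · rw [log_partitionFunction_edgesIn hs hU, Finset.sum_sub_distrib, Finset.sum_const,
      nsmul_eq_mul]
    ring
  · ring

end Revealing

section Sublattices

variable {d : ℕ}

/-- The sublattice of the nodes whose coordinates have an even sum. -/
def evenNodes (d : ℕ) : AddSubgroup (Fin d → ℤ) where
  carrier := {u | Even (∑ i, u i)}
  zero_mem' := by simp
  add_mem' hu hv := by
    simpa [Finset.sum_add_distrib] using Even.add hu hv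
  neg_mem' := by simp

theorem add_unitVector_mem_evenNodes {v : Fin d → ℤ} {p : Fin d × Bool} :
    v + unitVector p ∈ evenNodes d ↔ v ∉ evenNodes d := by
  obtain ⟨i, b⟩ := p
  have hsum : ∑ j, (v + unitVector (i, b)) j = ∑ j, v j + if b then 1 else -1 := by
    simp [Finset.sum_add_distrib, unitVector]
  change Even (∑ j, (v + unitVector (i, b)) j) ↔ ¬ Even (∑ j, v j)
  rw [hsum]
  cases b <;> simp [parity_simps]

theorem exists_mem_edge_mem_evenNodes (e : LatticeEdge d) :
    ∃ u ∈ (e : Sym2 (Fin d → ℤ)), u ∈ evenNodes d := by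
  obtain ⟨⟨v, w⟩, he⟩ := e
  obtain ⟨p, rfl⟩ := lattice_adj_iff.1 (show (lattice d).Adj v w from he)
  by_cases hv : v ∈ evenNodes d
  · exact ⟨v, Sym2.mem_mk_left _ _, hv⟩
  · exact ⟨_, Sym2.mem_mk_right _ _, add_unitVector_mem_evenNodes.2 hv⟩

theorem card_filter_le_add_card_escaping {P Q : (Fin d → ℤ) → Prop} [DecidablePred P]
    [DecidablePred Q] {x : Fin d → ℤ} (h : ∀ v, P v → Q (v + x)) (Λ : Finset (Fin d → ℤ)) :
    (Λ.filter P).card ≤ (Λ.filter Q).card + (escaping x Λ).card := by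
  classical
  have hmaps : Set.MapsTo (· + x) (Λ.filter P \ escaping x Λ : Finset (Fin d → ℤ))
      (Λ.filter Q : Finset (Fin d → ℤ)) := by
    intro v hv
    simp only [Finset.mem_coe, Finset.mem_sdiff, Finset.mem_filter, mem_escaping] at hv ⊢
    exact ⟨by tauto, h v hv.1.2⟩
  exact (Finset.card_le_card_sdiff_add_card (t := escaping x Λ)).trans (Nat.add_le_add_right
    (Finset.card_le_card_of_injOn _ hmaps (add_left_injective x).injOn) _)

open Classical in
theorem tendsto_card_evenNodes_div_card (hd : 0 < d) :
    Tendsto (fun Λ : Finset (Fin d → ℤ) => ((Λ.filter (· ∈ evenNodes d)).card : ℝ) / Λ.card)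
      (vanHove d) (𝓝 (1 / 2)) := by
  -- The translation by `x` exchanges the even and the odd nodes.
  let x := unitVector ((⟨0, hd⟩, true) : Fin d × Bool)
  refine tendsto_sub_nhds_zero_iff.1
    (squeeze_zero_norm' ?_ (tendsto_card_escaping_div_card x))
  filter_upwards [eventually_nonempty_vanHove] with Λ hne
  have hcard : (0 : ℝ) < Λ.card := by exact_mod_cast hne.card_pos
  have heven : ((Λ.filter (· ∈ evenNodes d)).card : ℝ) ≤
      (Λ.filter (· ∉ evenNodes d)).card + (escaping x Λ).card := by
    exact_mod_cast card_filter_le_add_card_escaping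
      (fun _ hv hv' => add_unitVector_mem_evenNodes.1 hv' hv) Λ
  have hodd : ((Λ.filter (· ∉ evenNodes d)).card : ℝ) ≤
      (Λ.filter (· ∈ evenNodes d)).card + (escaping x Λ).card := by
    exact_mod_cast card_filter_le_add_card_escaping
      (fun _ hv => add_unitVector_mem_evenNodes.2 hv) Λ
  have hsum : ((Λ.filter (· ∈ evenNodes d)).card : ℝ) + (Λ.filter (· ∉ evenNodes d)).card =
      Λ.card := by
    exact_mod_cast Finset.card_filter_add_card_filter_not (s := Λ) (· ∈ evenNodes d)
  rw [Real.norm_eq_abs, div_sub' hcard.ne', abs_div, abs_of_pos hcard]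
  gcongr
  exact abs_le.2 ⟨by linarith, by linarith⟩

open Classical in
theorem tendsto_card_top_div_card (d : ℕ) :
    Tendsto (fun Λ : Finset (Fin d → ℤ) =>
        ((Λ.filter (· ∈ (⊤ : AddSubgroup (Fin d → ℤ)))).card : ℝ) / Λ.card)
      (vanHove d) (𝓝 1) := by
  refine tendsto_const_nhds.congr' ?_
  filter_upwards [eventually_nonempty_vanHove] with Λ hne
  simp [hne.card_ne_zero]

theorem originEvent_eq_pinned {χ : Type*} (d : ℕ) (s : χ) :
    originEvent d s = pinned (edgesAt (d := d) 0) fun _ => s := by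
  simp only [originEvent, pinned, Finset.mem_coe, mem_edgesAt]

theorem laterEdges_eq_laterEdgesFrom_top (d : ℕ) : laterEdges d = laterEdgesFrom ⊤ 0 := by
  simp only [laterEdges, laterEdgesFrom, AddSubgroup.mem_top, and_true]

theorem laterEvenEdges_eq_laterEdgesFrom_evenNodes (d : ℕ) :
    laterEvenEdges d = laterEdgesFrom (evenNodes d) 0 := rfl

end Sublattices

end SpinSystem

theorem theorem3 {χ : Type*} [Fintype χ] [MeasurableSpace χ] [DiscreteMeasurableSpace χ]
    (d : ℕ) (hd : 0 < d) (M : SpinSystem.Model χ) (sstar : χ)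
    (hstar : ∀ s : χ, M.H s sstar ≠ ⊤)
    (hSSM : SpinSystem.StrongSpatialMixing (SpinSystem.edgeGraph d) M) :
    (∃! μ : Measure (SpinSystem.LatticeEdge d → χ),
        SpinSystem.IsGibbsMeasure (SpinSystem.edgeGraph d) M μ) ∧
      ∀ μ : Measure (SpinSystem.LatticeEdge d → χ),
        SpinSystem.IsGibbsMeasure (SpinSystem.edgeGraph d) M μ →
        ∃ P p pEven : ℝ, 0 < p ∧ 0 < pEven ∧
          SpinSystem.HasCondProb μ (SpinSystem.originEvent d sstar)
            (SpinSystem.laterEdges d) sstar p ∧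
          SpinSystem.HasCondProb μ (SpinSystem.originEvent d sstar)
            (SpinSystem.laterEvenEdges d) sstar pEven ∧
          SpinSystem.IsPressure d M P ∧
          P = -Real.log p
              - d * (2 * d - 1) * (M.H sstar sstar).untop (hstar sstar) - d * M.h sstar ∧
          P = -(1 / 2) * Real.log pEven
              - d * (2 * d - 1) * (M.H sstar sstar).untop (hstar sstar) - d * M.h sstar := by
  have hG := SpinSystem.edgeGraph_neighborSet_finite (d := d)
  refine ⟨hSSM.existsUnique_isGibbsMeasure hG hstar, fun μ hμ => ?_⟩
  obtain ⟨p, hp⟩ := hSSM.exists_hasBulkCondProb hG hstar (SpinSystem.edgesAt 0) (fun _ => sstar)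
    (SpinSystem.laterEdgesFrom ⊤ 0)
  obtain ⟨q, hq⟩ := hSSM.exists_hasBulkCondProb hG hstar (SpinSystem.edgesAt 0) (fun _ => sstar)
    (SpinSystem.laterEdgesFrom (SpinSystem.evenNodes d) 0)
  have hfull := hp.tendsto_log_partitionFunction_div_card hstar
    (fun e => ⟨_, Sym2.out_fst_mem _, trivial⟩) (SpinSystem.tendsto_card_top_div_card d)
  have heven := hq.tendsto_log_partitionFunction_div_card hstar
    SpinSystem.exists_mem_edge_mem_evenNodes (SpinSystem.tendsto_card_evenNodes_div_card hd)
  rw [SpinSystem.originEvent_eq_pinned, SpinSystem.laterEdges_eq_laterEdgesFrom_top,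
    SpinSystem.laterEvenEdges_eq_laterEdgesFrom_evenNodes]
  exact ⟨_, p, q, hp.pos hG hstar, hq.pos hG hstar, hp.hasCondProb hG hstar hμ,
    hq.hasCondProb hG hstar hμ, SpinSystem.isPressure_of_tendsto hfull, by ring,
    tendsto_nhds_unique hfull heven⟩
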